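/- **Setting.** Let $\mathcal H,\mathcal K$ be complex Hilbert spaces. Let $T_0$ be a densely defined closed linear operator in $\mathcal H$ with $\rho(T_0)\neq\emptyset$, and let $A$, $B$ be densely defined closed linear operators from $\mathcal H$ to $\mathcal K$ with $\operatorname{dom}(A)\supseteq\operatorname{dom}(T_0)$ and $\operatorname{dom}(B)\supseteq\operatorname{dom}(T_0^*)$. Suppose that for some (and hence for all) $z\in\rho(T_0)$ the operator $-A(T_0-z)^{-1}B^*$, defined on $\operatorname{dom}(B^*)$, has a bounded extension $K(z)=\overline{-A(T_0-z)^{-1}B^*}\in\mathcal B(\mathcal K)$, and that $1\in\rho(K(z_0))$ for some $z_0\in\rho(T_0)$. Let $T$ be the densely defined closed linear operator in $\mathcal H$ determined by $$(T-z)^{-1}=(T_0-z)^{-1}-\overline{(T_0-z)^{-1}B^*}\,[I_{\mathcal K}-K(z)]^{-1}A(T_0-z)^{-1},\qquad z\in\{\zeta\in\rho(T_0) : 1\in\rho(K(\zeta))\}.$$ An operator $D$ in $\mathcal H$ is called m-accretive if for all $\zeta\in\mathbb C$ with $\operatorname{Re}\zeta>0$ one has $(D+\zeta)^{-1}\in\mathcal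 B(\mathcal H)$ and $\|(D+\zeta)^{-1}\|\le(\operatorname{Re}\zeta)^{-1}$. For m-accretive $D$, $0<\beta<1$ and $\varepsilon>0$ put $$(D+\varepsilon)^{-\beta}=\frac{\sin(\pi\beta)}{\pi}\int_0^\infty \lambda^{-\beta}(D+\varepsilon+\lambda)^{-1}\,d\lambda\in\mathcal B(\mathcal H),$$ let $(D+\varepsilon)^{\beta}$ be its inverse, and let $D^\beta u=\lim_{\varepsilon\downarrow0}(D+\varepsilon)^\beta u$, with domain the set of all $u\in\bigcap_{\varepsilon>0}\operatorname{dom}((D+\varepsilon)^\beta)$ for which the limit exists. **Theorem 2.9.** Let $\alpha\in(0,1)$. Suppose in addition that $T_0$ and $T$ are m-accretive, that $$\operatorname{dom}(T_0^\alpha)=\operatorname{dom}((T_0^*)^\alpha),$$ and that $$\operatorname{dom}(A)\supseteq\operatorname{dom}(T_0^{1-\alpha}),\qquad \operatorname{dom}(B)\supseteq\operatorname{dom}((T_0^*)^{1-\alpha}).$$ If there exist constants $R>0$, $E_0>0$ and $0<\delta<1$ such that $$\int_R^\infty \lambda^{-2\alpha}\,\bigl\|\overline{(T_0+E+\lambda)^{\alpha-1}B^*}\bigr\|_{\mathcal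 B(\mathcal K,\mathcal H)}\,\bigl\|A(T_0+E+\lambda)^{\alpha-1}\bigr\|_{\mathcal B(\mathcal H,\mathcal K)}\,d\lambda<\infty,\qquad E\ge E_0,$$ $$\lim_{E\to\infty}\int_R^\infty \lambda^{-2\alpha}\,\bigl\|\overline{(T_0+E+\lambda)^{\alpha-1}B^*}\bigr\|_{\mathcal B(\mathcal K,\mathcal H)}\,\bigl\|A(T_0+E+\lambda)^{\alpha-1}\bigr\|_{\mathcal B(\mathcal H,\mathcal K)}\,d\lambda=0,$$ $$\|K(-E)\|_{\mathcal B(\mathcal K)}\le1-\delta,\qquad E\ge E_0,$$ then $$\operatorname{dom}(T^\alpha)=\operatorname{dom}(T_0^\alpha)=\operatorname{dom}((T_0^*)^\alpha)=\operatorname{dom}((T^*)^\alpha).$$ -/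

import Mathlib

namespace KatoSum

open MeasureTheory Filter Topology

/-! ### Unbounded operators: composition, bounded extension, resolvent -/

section General

variable {E F G : Type*} [NormedAddCommGroup E] [InnerProductSpace ℂ E]
  [NormedAddCommGroup F] [InnerProductSpace ℂ F] [NormedAddCommGroup G] [InnerProductSpace ℂ G]

/-- The product `S T` of two linear operators on its natural domain
`{x ∈ dom T | T x ∈ dom S}`. -/
def prod (S : F →ₗ.[ℂ] G) (T : E →ₗ.[ℂ] F) : E →ₗ.[ℂ] G where
  domain := (S.domain.comap T.toFun).map T.domain.subtype
  toFun :=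
    { toFun := fun x => S ⟨T ⟨x, by
          obtain ⟨y, -, hy⟩ := x.2
          rw [← hy]; exact y.2⟩, by
          obtain ⟨x, y, hyS, rfl⟩ := x
          exact hyS⟩
      map_add' := fun x y => by
        rw [← LinearPMap.map_add]
        congr 1
        apply Subtype.ext
        change T _ = T _ + T _
        rw [← LinearPMap.map_add]
        rfl
      map_smul' := fun c x => by
        rw [RingHom.id_apply, ← LinearPMap.map_smul]
        congr 1
        apply Subtype.ext
        change T _ = c • T _
        rw [← LinearPMap.map_smul]
        rfl }

/-- A bounded, everywhere defined operator, regarded as an unbounded one. -/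
def ofCLM (L : E →L[ℂ] F) : E →ₗ.[ℂ] F :=
  (L : E →ₗ[ℂ] F).toPMap ⊤

/-- `L` is a bounded, everywhere defined extension of `S`. -/
def IsBddExt (S : E →ₗ.[ℂ] F) (L : E →L[ℂ] F) : Prop :=
  ∀ x : S.domain, L x = S x

open Classical in
/-- For a densely defined operator `S` that is bounded on its domain, this is its unique bounded
extension to the whole space, that is, its closure `S̄ ∈ B(E, F)`; in particular it is `S` itself
if `S` is bounded and everywhere defined. (It is `0` if `S` has no bounded extension.) -/
noncomputable def bddClosure (S : E →ₗ.[ℂ] F) : E →L[ℂ] F :=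
  if h : ∃ L : E →L[ℂ] F, IsBddExt S L then h.choose else 0

/-- The bounded operator `R` is a two-sided inverse of `T - z : dom T → E`. -/
def IsResolvent (T : E →ₗ.[ℂ] E) (z : ℂ) (R : E →L[ℂ] E) : Prop :=
  (∀ f : E, ∃ h : R f ∈ T.domain, T ⟨R f, h⟩ - z • R f = f) ∧
    ∀ u : T.domain, R (T u - z • (u : E)) = u

/-- The resolvent set `ρ(T)` of an unbounded operator. -/
def resolventSet (T : E →ₗ.[ℂ] E) : Set ℂ :=
  {z | ∃ R : E →L[ℂ] E, IsResolvent T z R}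

open Classical in
/-- The resolvent `(T - z)⁻¹` for `z ∈ ρ(T)` (and `0` for all other `z`). -/
noncomputable def resolvent (T : E →ₗ.[ℂ] E) (z : ℂ) : E →L[ℂ] E :=
  if h : ∃ R : E →L[ℂ] E, IsResolvent T z R then h.choose else 0

/-- `T` is m-accretive: for all `ζ` with `Re ζ > 0`, the operator `T + ζ` has a bounded,
everywhere defined inverse, of norm at most `(Re ζ)⁻¹`. -/
def IsMAccretive (T : E →ₗ.[ℂ] E) : Prop :=
  ∀ ζ : ℂ, 0 < ζ.re → -ζ ∈ resolventSet T ∧ ‖resolvent T (-ζ)‖ ≤ (ζ.re)⁻¹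

/-- The bounded operator
`(T + ε)^{-β} = (sin (πβ) / π) ∫₀^∞ t^{-β} (T + ε + t)⁻¹ dt`,
for an m-accretive `T`, `ε > 0` and `0 < β < 1`. -/
noncomputable def negPow (T : E →ₗ.[ℂ] E) (ε β : ℝ) : E →L[ℂ] E :=
  ((Real.sin (Real.pi * β) / Real.pi : ℝ) : ℂ) •
    ∫ t in Set.Ioi (0 : ℝ), ((t ^ (-β) : ℝ) : ℂ) • resolvent T (-((ε + t : ℝ) : ℂ))

/-- The graph of the fractional power `T^β`, for an m-accretive `T` and `0 < β < 1`:
`T^β u = lim_{ε ↓ 0} (T + ε)^β u`, where `(T + ε)^β` is the inverse of the injective bounded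
operator `(T + ε)^{-β}`, and `u` is in the domain of `T^β` if it is in the domain of all
`(T + ε)^β` and the limit exists. In the definition, `w ε` is `(T + ε)^β u`. -/
def fracPowGraph (T : E →ₗ.[ℂ] E) (β : ℝ) : Submodule ℂ (E × E) where
  carrier := {p | ∃ w : ℝ → E, (∀ ε : ℝ, 0 < ε → negPow T ε β (w ε) = p.1) ∧
    Tendsto w (𝓝[>] 0) (𝓝 p.2)}
  zero_mem' := ⟨fun _ => 0, fun _ _ => by simp, tendsto_const_nhds⟩
  add_mem' := by
    rintro p q ⟨w, hw, hw'⟩ ⟨v, hv, hv'⟩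
    exact ⟨fun ε => w ε + v ε, fun ε hε => by simp [hw ε hε, hv ε hε], hw'.add hv'⟩
  smul_mem' := by
    rintro c p ⟨w, hw, hw'⟩
    exact ⟨fun ε => c • w ε, fun ε hε => by simp [hw ε hε], hw'.const_smul c⟩

/-- The fractional power `T^β` of an m-accretive operator `T`, for `0 < β < 1`. -/
noncomputable def fracPow (T : E →ₗ.[ℂ] E) (β : ℝ) : E →ₗ.[ℂ] E :=
  (fracPowGraph T β).toLinearPMap

end General

/-! ### The generalized sum `T` of `T₀` and `B* A` -/

section Sum

variable {H K : Type*} [NormedAddCommGroup H] [InnerProductSpace ℂ H] [CompleteSpace H]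
  [NormedAddCommGroup K] [InnerProductSpace ℂ K] [CompleteSpace K]

/-- The operator `-A (T₀ - z)⁻¹ B*` from `K` to `K`, with domain `dom B*`
(if `dom T₀ ⊆ dom A`). -/
noncomputable def birmanSchwingerMin (T₀ : H →ₗ.[ℂ] H) (A B : H →ₗ.[ℂ] K) (z : ℂ) :
    K →ₗ.[ℂ] K :=
  -(prod A (prod (ofCLM (resolvent T₀ z)) B.adjoint))

/-- The operator `K(z)`, the bounded closure of `-A (T₀ - z)⁻¹ B*`. -/
noncomputable def birmanSchwinger (T₀ : H →ₗ.[ℂ] H) (A B : H →ₗ.[ℂ] K) (z : ℂ) : K →L[ℂ] K :=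
  bddClosure (birmanSchwingerMin T₀ A B z)

/-- The set of all `z ∈ ρ(T₀)` with `1 ∈ ρ(K(z))`. -/
def admissible (T₀ : H →ₗ.[ℂ] H) (A B : H →ₗ.[ℂ] K) : Set ℂ :=
  {z | z ∈ resolventSet T₀ ∧ (1 : ℂ) ∈ _root_.resolventSet ℂ (birmanSchwinger T₀ A B z)}

/-- The standing assumptions on `T₀`, `A` and `B`. -/
structure Hypotheses (T₀ : H →ₗ.[ℂ] H) (A B : H →ₗ.[ℂ] K) : Prop where
  dense_T₀ : Dense (T₀.domain : Set H)
  closed_T₀ : T₀.IsClosed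
  resolventSet_nonempty : (resolventSet T₀).Nonempty
  dense_A : Dense (A.domain : Set H)
  closed_A : A.IsClosed
  dense_B : Dense (B.domain : Set H)
  closed_B : B.IsClosed
  dom_A : T₀.domain ≤ A.domain
  dom_B : T₀.adjoint.domain ≤ B.domain
  bdd : ∃ z ∈ resolventSet T₀, ∃ L : K →L[ℂ] K, IsBddExt (birmanSchwingerMin T₀ A B z) L
  admissible_nonempty : (admissible T₀ A B).Nonempty

/-- `R(z) = (T₀ - z)⁻¹ - \overline{(T₀ - z)⁻¹ B*} [1 - K(z)]⁻¹ A (T₀ - z)⁻¹`. -/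
noncomputable def katoResolvent (T₀ : H →ₗ.[ℂ] H) (A B : H →ₗ.[ℂ] K) (z : ℂ) : H →L[ℂ] H :=
  resolvent T₀ z -
    bddClosure (prod (ofCLM (resolvent T₀ z)) B.adjoint) ∘L
      Ring.inverse (1 - birmanSchwinger T₀ A B z) ∘L
        bddClosure (prod A (ofCLM (resolvent T₀ z)))

/-- The graph of the operator `T` that is determined by `(T - z)⁻¹ = R(z)` for all admissible `z`:
`(u, v)` is in it if and only if `u = R(z) (v - z u)` for all admissible `z`. -/
def katoGraph (T₀ : H →ₗ.[ℂ] H) (A B : H →ₗ.[ℂ] K) : Submodule ℂ (H × H) where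
  carrier := {p | ∀ z ∈ admissible T₀ A B, katoResolvent T₀ A B z (p.2 - z • p.1) = p.1}
  zero_mem' := fun z _ => by simp
  add_mem' := by
    intro p q hp hq z hz
    have h : (p + q).2 - z • (p + q).1 = (p.2 - z • p.1) + (q.2 - z • q.1) := by
      simp only [Prod.fst_add, Prod.snd_add, smul_add]
      abel
    rw [h, map_add, hp z hz, hq z hz, Prod.fst_add]
  smul_mem' := by
    intro c p hp z hz
    have h : (c • p).2 - z • (c • p).1 = c • (p.2 - z • p.1) := by
      simp only [Prod.smul_fst, Prod.smul_snd, smul_sub, smul_comm c z]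
    rw [h, map_smul, hp z hz, Prod.smul_fst]

/-- The generalized sum `T` of `T₀` and `B* A`, with `(T - z)⁻¹ = R(z)` for all admissible `z`. -/
noncomputable def katoSum (T₀ : H →ₗ.[ℂ] H) (A B : H →ₗ.[ℂ] K) : H →ₗ.[ℂ] H :=
  (katoGraph T₀ A B).toLinearPMap

/-- `‖\overline{(T₀ + s)^{α-1} B*}‖ ‖A (T₀ + s)^{α-1}‖`. -/
noncomputable def normProd (T₀ : H →ₗ.[ℂ] H) (A B : H →ₗ.[ℂ] K) (α s : ℝ) : ℝ :=
  ‖bddClosure (prod (ofCLM (negPow T₀ s (1 - α))) B.adjoint)‖ *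
    ‖bddClosure (prod A (ofCLM (negPow T₀ s (1 - α))))‖

end Sum

end KatoSum

open MeasureTheory Filter Topology

/-! For an m-accretive `D`, the domain of `D^α` is the range of `(D + E)^{-α}`, for any single `E >
0` (`IsMAccretive.fracPow_domain`). So it suffices to compare ranges of bounded operators at one
large `E`. If `‖(S - S₀) f‖ ≤ κ ‖S₀ f‖` for all `f`, with `κ < 1`, then `‖S f‖` and `‖S₀ f‖` are
comparable and `S*`, `S₀*` have the same range (`range_adjoint_eq_of_norm_sub_le`). With `S = (T +
E)^{-α}` and `S₀ = (T₀ + E)^{-α}` this yields the equality for `T*` and `T₀*`; with the adjoints of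
these operators it yields the one for `T` and `T₀`. The middle equality is a hypothesis.

The relative bound (`exists_relative_bound`) comes from integrating `t^{-α} [(T + s)⁻¹ - (T₀ +
s)⁻¹]` with `s = E + t`. Writing `(T₀ + s)⁻¹` as a multiple of `(T₀ + s)^{-α} (T₀ + s)^{α-1}` in
Kato's formula turns the bracket, up to a constant, into the product of `(T₀ + s)^{-α}`, the closure
of `(T₀ + s)^{α-1} B*`, `[1 - K(-s)]⁻¹`, `A (T₀ + s)^{α-1}` and `(T₀ + s)^{-α}`. The three inner
factors have norm at most `δ⁻¹ normProd`. One outer factor gives the decay `s^{-α}`; the other is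
dominated by `(T₀ + E)^{-α}`, because `(T₀ + E)^α (T₀ + s)^{-α}` is bounded uniformly in `s ≥ E`.
The remaining scalar integral tends to `0` as `E → ∞`.

The calculus of fractional powers is derived from the resolvent identity alone. Its constants are
never evaluated: only their sign or non-vanishing matters. -/

namespace KatoSum

/-! ### Fractional integrals of abstract resolvent families and their product formula. -/

section ResolventFamily

variable {𝒜 : Type*} [NormedRing 𝒜] [NormedAlgebra ℝ 𝒜]

/-- A family with the properties of the resolvents `R t = (D + t)⁻¹`, `t > 0`, of an m-accretive
operator `D`. -/
structure IsResolventFamily (R : ℝ → 𝒜) : Prop where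
  norm_le : ∀ t, 0 < t → ‖R t‖ ≤ t⁻¹
  sub_eq : ∀ s t, 0 < s → 0 < t → R s - R t = (t - s) • (R s * R t)
  cancel : ∀ t, 0 < t → ∀ x, R t * x = 0 → x = 0

/-- The integral `∫₀^∞ t^{-β} R(ε + t) dt`, a multiple of `(D + ε)^{-β}`. -/
noncomputable def fracInt (R : ℝ → 𝒜) (β ε : ℝ) : 𝒜 :=
  ∫ t in Set.Ioi (0 : ℝ), t ^ (-β) • R (ε + t)

/-- The value of `∫₀^∞ t^{-β} (1 + t)⁻¹ dt`. -/
noncomputable def fracConst (β : ℝ) : ℝ :=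
  ∫ t in Set.Ioi (0 : ℝ), t ^ (-β) * (1 + t)⁻¹

theorem integrableOn_rpow_mul_inv {β ε : ℝ} (h0 : 0 < β) (h1 : β < 1) (hε : 0 < ε) :
    IntegrableOn (fun t : ℝ => t ^ (-β) * (ε + t)⁻¹) (Set.Ioi 0) := by
  have hmeas : Measurable (fun t : ℝ => t ^ (-β) * (ε + t)⁻¹) := by fun_prop
  rw [← Set.Ioc_union_Ioi_eq_Ioi (zero_le_one' ℝ)]
  refine IntegrableOn.union ?_ ?_
  · have h : IntegrableOn (fun t : ℝ => t ^ (-β) * ε⁻¹) (Set.Ioc 0 1) :=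
      ((intervalIntegrable_iff_integrableOn_Ioc_of_le zero_le_one).1
        (intervalIntegral.intervalIntegrable_rpow' (by linarith))).mul_const _
    refine Integrable.mono' h hmeas.aestronglyMeasurable ?_
    filter_upwards [ae_restrict_mem measurableSet_Ioc] with t ht
    have ht0 : 0 < t := ht.1
    rw [Real.norm_of_nonneg (by positivity)]
    gcongr
    linarith
  · have h : IntegrableOn (fun t : ℝ => t ^ (-β - 1)) (Set.Ioi 1) :=
      integrableOn_Ioi_rpow_of_lt (by linarith) one_pos
    refine Integrable.mono' h hmeas.aestronglyMeasurable ?_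
    filter_upwards [ae_restrict_mem measurableSet_Ioi] with t ht
    have ht0 : 0 < t := one_pos.trans ht
    rw [Real.norm_of_nonneg (by positivity), Real.rpow_sub_one ht0.ne', div_eq_mul_inv]
    gcongr
    linarith

theorem integral_rpow_mul_inv {β ε : ℝ} (hε : 0 < ε) :
    ∫ t in Set.Ioi (0 : ℝ), t ^ (-β) * (ε + t)⁻¹ = ε ^ (-β) * fracConst β := by
  have h := integral_comp_mul_left_Ioi (fun t : ℝ => t ^ (-β) * (ε + t)⁻¹) 0 hε
  rw [mul_zero, smul_eq_mul] at h
  have h2 : ∫ x in Set.Ioi (0 : ℝ), (ε * x) ^ (-β) * (ε + ε * x)⁻¹ =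
      ε⁻¹ * (ε ^ (-β) * fracConst β) := by
    rw [fracConst, ← integral_const_mul, ← integral_const_mul]
    refine setIntegral_congr_fun measurableSet_Ioi fun t ht => ?_
    have ht0 : 0 < t := ht
    rw [Real.mul_rpow hε.le ht0.le, show ε + ε * t = ε * (1 + t) by ring, mul_inv]
    ring
  rw [h2] at h
  exact (mul_left_cancel₀ (inv_ne_zero hε.ne') h).symm

theorem fracConst_nonneg (β : ℝ) : 0 ≤ fracConst β :=
  setIntegral_nonneg measurableSet_Ioi fun t ht => by
    have : (0 : ℝ) < t := ht
    positivity

theorem fracConst_pos {β : ℝ} (h0 : 0 < β) (h1 : β < 1) : 0 < fracConst β := by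
  refine (setIntegral_pos_iff_support_of_nonneg_ae ?_
    (integrableOn_rpow_mul_inv h0 h1 one_pos)).2 ?_
  · filter_upwards [ae_restrict_mem measurableSet_Ioi] with t ht
    have : (0 : ℝ) < t := ht
    simp only [Pi.zero_apply]
    positivity
  · have : (Function.support fun t : ℝ => t ^ (-β) * (1 + t)⁻¹) ∩ Set.Ioi 0 = Set.Ioi 0 := by
      refine Set.inter_eq_right.2 fun t ht => ?_
      have : (0 : ℝ) < t := ht
      rw [Function.mem_support]
      positivity
    rw [this]
    simp

namespace IsResolventFamily

variable {R : ℝ → 𝒜} (hR : IsResolventFamily R)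
include hR

theorem commute {s t : ℝ} (hs : 0 < s) (ht : 0 < t) : Commute (R s) (R t) := by
  rcases eq_or_ne s t with rfl | hst
  · exact Commute.refl _
  have h1 := hR.sub_eq s t hs ht
  have h2 := hR.sub_eq t s ht hs
  have h3 : (t - s) • (R s * R t) = (t - s) • (R t * R s) := by
    rw [← h1, ← neg_sub, h2, ← neg_smul, neg_sub]
  exact smul_right_injective 𝒜 (sub_ne_zero.2 hst.symm) h3

theorem continuousOn : ContinuousOn R (Set.Ioi 0) := by
  intro t ht
  have ht0 : 0 < t := ht
  have hev : ∀ᶠ s in 𝓝 t, t / 2 < s := lt_mem_nhds (by linarith)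
  refine ContinuousAt.continuousWithinAt ?_
  rw [ContinuousAt, tendsto_iff_norm_sub_tendsto_zero]
  have hlim : Tendsto (fun s : ℝ => |t - s| * ((t / 2)⁻¹ * t⁻¹)) (𝓝 t) (𝓝 0) := by
    have : Continuous fun s : ℝ => |t - s| * ((t / 2)⁻¹ * t⁻¹) := by fun_prop
    simpa using this.tendsto t
  refine squeeze_zero' (Eventually.of_forall fun _ => norm_nonneg _) ?_ hlim
  filter_upwards [hev] with s hs
  have hs0 : 0 < s := by linarith
  rw [hR.sub_eq s t hs0 ht0, norm_smul, Real.norm_eq_abs]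
  gcongr
  refine (norm_mul_le _ _).trans ?_
  gcongr
  · exact (hR.norm_le s hs0).trans (by gcongr)
  · exact hR.norm_le t ht0

theorem continuousOn_add {ε : ℝ} (hε : 0 < ε) : ContinuousOn (fun t => R (ε + t)) (Set.Ioi 0) :=
  hR.continuousOn.comp (by fun_prop) fun t ht => add_pos hε ht

theorem norm_add_le {ε t : ℝ} (hε : 0 < ε) (ht : 0 < t) : ‖R (ε + t)‖ ≤ (ε + t)⁻¹ :=
  hR.norm_le _ (add_pos hε ht)

theorem integrableOn_rpow_smul {β ε : ℝ} (h0 : 0 < β) (h1 : β < 1) (hε : 0 < ε) :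
    IntegrableOn (fun t : ℝ => t ^ (-β) • R (ε + t)) (Set.Ioi 0) := by
  refine Integrable.mono' (integrableOn_rpow_mul_inv h0 h1 hε) ?_ ?_
  · refine ContinuousOn.aestronglyMeasurable ?_ measurableSet_Ioi
    exact (continuousOn_id.rpow_const fun t ht => Or.inl (ne_of_gt ht)).smul
      (hR.continuousOn_add hε)
  · filter_upwards [ae_restrict_mem measurableSet_Ioi] with t ht
    have ht0 : 0 < t := ht
    rw [norm_smul, Real.norm_of_nonneg (by positivity)]
    gcongr
    exact hR.norm_add_le hε ht0

theorem norm_fracInt_le {β ε : ℝ} (h0 : 0 < β) (h1 : β < 1) (hε : 0 < ε) :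
    ‖fracInt R β ε‖ ≤ ε ^ (-β) * fracConst β := by
  rw [← integral_rpow_mul_inv hε]
  refine norm_integral_le_of_norm_le (integrableOn_rpow_mul_inv h0 h1 hε) ?_
  filter_upwards [ae_restrict_mem measurableSet_Ioi] with t ht
  have ht0 : 0 < t := ht
  rw [norm_smul, Real.norm_of_nonneg (by positivity)]
  gcongr
  exact hR.norm_add_le hε ht0

theorem commute_fracInt {β ε : ℝ} (h0 : 0 < β) (h1 : β < 1) (hε : 0 < ε) {x : 𝒜}
    (hx : ∀ t, 0 < t → Commute x (R t)) : Commute x (fracInt R β ε) := by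
  have hi := hR.integrableOn_rpow_smul h0 h1 hε
  rw [Commute, SemiconjBy, fracInt, ← integral_const_mul_of_integrable hi,
    ← integral_mul_const_of_integrable hi]
  refine setIntegral_congr_fun measurableSet_Ioi fun t ht => ?_
  have ht0 : 0 < t := ht
  rw [mul_smul_comm, smul_mul_assoc, (hx _ (add_pos hε ht0)).eq]

theorem aestronglyMeasurable_prod {β ε : ℝ} (hε : 0 < ε) :
    AEStronglyMeasurable
      (Function.uncurry fun s r : ℝ => r ^ (-(1 - β)) • (R (ε + s) * R (ε + r * s)))
      ((volume.restrict (Set.Ioi 0)).prod (volume.restrict (Set.Ioi 0))) := by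
  rw [Measure.prod_restrict]
  refine ContinuousOn.aestronglyMeasurable ?_ (measurableSet_Ioi.prod measurableSet_Ioi)
  refine ContinuousOn.smul (f := fun p : ℝ × ℝ => p.2 ^ (-(1 - β)))
    (g := fun p : ℝ × ℝ => R (ε + p.1) * R (ε + p.2 * p.1)) ?_ (ContinuousOn.mul ?_ ?_)
  · exact continuousOn_snd.rpow_const fun p hp => Or.inl (ne_of_gt hp.2)
  · exact hR.continuousOn.comp (by fun_prop) fun p hp => add_pos hε hp.1
  · exact hR.continuousOn.comp (by fun_prop) fun p hp => add_pos hε (mul_pos hp.2 hp.1)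

end IsResolventFamily

theorem integrableOn_rpow_mul_inv_mul {β ε s : ℝ} (h0 : 0 < β) (h1 : β < 1) (hε : 0 < ε)
    (hs : 0 < s) :
    IntegrableOn (fun r : ℝ => r ^ (-β) * (ε + r * s)⁻¹) (Set.Ioi 0) := by
  have h : (fun r : ℝ => r ^ (-β) * (ε + r * s)⁻¹) =
      fun r => s⁻¹ * (r ^ (-β) * (ε / s + r)⁻¹) := by
    funext r
    rw [show ε + r * s = s * (ε / s + r) by field_simp, mul_inv]
    ring
  rw [h]
  exact (integrableOn_rpow_mul_inv h0 h1 (div_pos hε hs)).const_mul _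

theorem integral_rpow_mul_inv_mul {β ε s : ℝ} (hε : 0 < ε) (hs : 0 < s) :
    ∫ r in Set.Ioi (0 : ℝ), r ^ (-β) * (ε + r * s)⁻¹ = s ^ (β - 1) * (ε ^ (-β) * fracConst β) := by
  have h : (fun r : ℝ => r ^ (-β) * (ε + r * s)⁻¹) =
      fun r => s⁻¹ * (r ^ (-β) * (ε / s + r)⁻¹) := by
    funext r
    rw [show ε + r * s = s * (ε / s + r) by field_simp, mul_inv]
    ring
  rw [h, integral_const_mul, integral_rpow_mul_inv (div_pos hε hs), Real.div_rpow hε.le hs.le,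
    Real.rpow_neg hs.le β, Real.rpow_sub_one hs.ne']
  have := Real.rpow_pos_of_pos hs β
  field_simp

namespace IsResolventFamily

variable {R : ℝ → 𝒜} (hR : IsResolventFamily R)
include hR

/-- Justifies Fubini in the product formula. In the scalar majorant, the inner integral over `r` is
a multiple of `s^{-β}`, which leaves the convergent integral of `s^{-β} (ε + s)⁻¹`. -/
theorem integrable_prod {β ε : ℝ} (h0 : 0 < β) (h1 : β < 1) (hε : 0 < ε) :
    Integrable
      (Function.uncurry fun s r : ℝ => r ^ (-(1 - β)) • (R (ε + s) * R (ε + r * s)))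
      ((volume.restrict (Set.Ioi 0)).prod (volume.restrict (Set.Ioi 0))) := by
  have hmeas : Measurable fun p : ℝ × ℝ =>
      p.2 ^ (-(1 - β)) * ((ε + p.1)⁻¹ * (ε + p.2 * p.1)⁻¹) := by fun_prop
  have hbound : Integrable
      (fun p : ℝ × ℝ => p.2 ^ (-(1 - β)) * ((ε + p.1)⁻¹ * (ε + p.2 * p.1)⁻¹))
      ((volume.restrict (Set.Ioi 0)).prod (volume.restrict (Set.Ioi 0))) := by
    refine (integrable_prod_iff hmeas.aestronglyMeasurable).2 ⟨?_, ?_⟩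
    · filter_upwards [ae_restrict_mem measurableSet_Ioi] with s hs
      refine ((integrableOn_rpow_mul_inv_mul (β := 1 - β) (by linarith) (by linarith) hε
        hs).const_mul (ε + s)⁻¹).congr (Eventually.of_forall fun r => ?_)
      simp only
      ring
    · refine ((integrableOn_rpow_mul_inv h0 h1 hε).mul_const
        (ε ^ (-(1 - β)) * fracConst (1 - β))).congr ?_
      filter_upwards [ae_restrict_mem measurableSet_Ioi] with s hs
      have hs0 : 0 < s := hs
      have : ∫ r in Set.Ioi (0 : ℝ), ‖r ^ (-(1 - β)) * ((ε + s)⁻¹ * (ε + r * s)⁻¹)‖ =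
          ∫ r in Set.Ioi (0 : ℝ), (ε + s)⁻¹ * (r ^ (-(1 - β)) * (ε + r * s)⁻¹) := by
        refine setIntegral_congr_fun measurableSet_Ioi fun r hr => ?_
        have hr0 : 0 < r := hr
        rw [Real.norm_of_nonneg (by positivity)]
        ring
      rw [this, integral_const_mul, integral_rpow_mul_inv_mul hε hs,
        show 1 - β - 1 = -β by ring]
      ring
  refine Integrable.mono' hbound (hR.aestronglyMeasurable_prod hε) ?_
  rw [Measure.prod_restrict]
  filter_upwards [ae_restrict_mem (measurableSet_Ioi.prod measurableSet_Ioi)] with p hp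
  have h1 : 0 < p.1 := hp.1
  have h2 : 0 < p.2 := hp.2
  simp only [Function.uncurry]
  rw [norm_smul, Real.norm_of_nonneg (by positivity)]
  gcongr
  refine (norm_mul_le _ _).trans ?_
  gcongr
  · exact hR.norm_add_le hε h1
  · exact hR.norm_add_le hε (mul_pos h2 h1)

theorem tendsto_atTop (ε : ℝ) : Tendsto (fun t => R (ε + t)) atTop (𝓝 0) := by
  have : Tendsto (fun t : ℝ => (ε + t)⁻¹) atTop (𝓝 0) :=
    tendsto_inv_atTop_zero.comp (tendsto_atTop_add_const_left _ _ tendsto_id)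
  refine squeeze_zero_norm' ?_ this
  filter_upwards [eventually_gt_atTop (-ε)] with t ht
  exact hR.norm_le _ (by linarith)

theorem tendsto_nhdsGT_zero {ε : ℝ} (hε : 0 < ε) :
    Tendsto (fun t => R (ε + t)) (𝓝[>] 0) (𝓝 (R ε)) := by
  have h : ContinuousAt R (ε + 0) := by
    rw [add_zero]
    exact hR.continuousOn.continuousAt (Ioi_mem_nhds hε)
  have h2 : ContinuousAt (fun t => R (ε + t)) 0 :=
    ContinuousAt.comp (f := fun t => ε + t) h (by fun_prop)
  have := h2.tendsto
  simp only [add_zero] at this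
  exact this.mono_left nhdsWithin_le_nhds

variable [CompleteSpace 𝒜]

/-- By the resolvent identity, `R(ε + s) R(ε + r s)` equals `[R(ε + s) - R(ε + r s)] / ((r - 1) s)`,
so this is a Frullani integral: only the limits `R ε` at `0` and `0` at infinity enter. -/
theorem integral_mul_eq {β ε r : ℝ} (hε : 0 < ε) (hr : 0 < r) (hr1 : r ≠ 1)
    (hint : IntegrableOn (fun s => r ^ (-(1 - β)) • (R (ε + s) * R (ε + r * s))) (Set.Ioi 0)) :
    ∫ s in Set.Ioi (0 : ℝ), r ^ (-(1 - β)) • (R (ε + s) * R (ε + r * s)) =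
      (r ^ (-(1 - β)) * (Real.log r / (r - 1))) • R ε := by
  have hr' : r - 1 ≠ 0 := sub_ne_zero.2 hr1
  have hrp : r ^ (-(1 - β)) ≠ 0 := (Real.rpow_pos_of_pos hr _).ne'
  have key : ∀ s ∈ Set.Ioi (0 : ℝ), (r ^ (-(1 - β)) / (r - 1)) •
      (s⁻¹ • (R (ε + 1 * s) - R (ε + r * s))) =
      r ^ (-(1 - β)) • (R (ε + s) * R (ε + r * s)) := by
    intro s hs
    have hs0 : 0 < s := hs
    rw [one_mul, hR.sub_eq _ _ (add_pos hε hs) (add_pos hε (mul_pos hr hs)), smul_smul, smul_smul]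
    congr 1
    field_simp
    ring
  have hint2 : IntegrableOn (fun s => s⁻¹ • (R (ε + 1 * s) - R (ε + r * s))) (Set.Ioi 0) := by
    have h1 := (integrableOn_congr_fun key measurableSet_Ioi).2 hint
    have h2 := h1.smul (r ^ (-(1 - β)) / (r - 1))⁻¹
    refine h2.congr (Eventually.of_forall fun s => ?_)
    simp only [Pi.smul_apply]
    rw [inv_smul_smul₀ (div_ne_zero hrp hr')]
  rw [← setIntegral_congr_fun measurableSet_Ioi key, integral_smul,
    Frullani.integral_Ioi_eq (f := fun t => R (ε + t))
      ((hR.continuousOn_add hε).locallyIntegrableOn measurableSet_Ioi)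
      one_pos hr (hR.tendsto_nhdsGT_zero hε) (hR.tendsto_atTop ε) hint2, sub_zero, div_one,
    smul_smul]
  congr 1
  ring

end IsResolventFamily

/-- The constant in the product formula for `fracInt R β ε * fracInt R (1 - β) ε`. -/
noncomputable def prodConst (β : ℝ) : ℝ :=
  ∫ r in Set.Ioi (0 : ℝ), r ^ (-(1 - β)) * (Real.log r / (r - 1))

/-- This is `(D + ε)^{-β} (D + ε)^{β-1} = (D + ε)⁻¹` without normalization. Substituting `t = r s`
in the second integral and exchanging the integrals leaves a Frullani integral in `s` for each `r`.
-/
theorem IsResolventFamily.fracInt_mul_fracInt [CompleteSpace 𝒜] {R : ℝ → 𝒜}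
    (hR : IsResolventFamily R) {β ε : ℝ} (h0 : 0 < β) (h1 : β < 1) (hε : 0 < ε) :
    fracInt R β ε * fracInt R (1 - β) ε = prodConst β • R ε := by
  have hprod := hR.integrable_prod h0 h1 hε
  have e1 : fracInt R β ε * fracInt R (1 - β) ε = ∫ s in Set.Ioi (0 : ℝ),
      ∫ r in Set.Ioi (0 : ℝ), r ^ (-(1 - β)) • (R (ε + s) * R (ε + r * s)) := by
    rw [fracInt, ← integral_mul_const_of_integrable (hR.integrableOn_rpow_smul h0 h1 hε)]
    refine setIntegral_congr_fun measurableSet_Ioi fun s hs => ?_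
    have hs0 : 0 < s := hs
    have hi := hR.integrableOn_rpow_smul (β := 1 - β) (by linarith) (by linarith) hε
    have e2 := integral_comp_mul_left_Ioi (fun t => t ^ (-(1 - β)) • R (ε + t)) 0 hs0
    rw [mul_zero] at e2
    have e3 : fracInt R (1 - β) ε =
        s • ∫ r in Set.Ioi (0 : ℝ), (s * r) ^ (-(1 - β)) • R (ε + s * r) := by
      rw [e2, smul_inv_smul₀ hs0.ne', fracInt]
    have hi2 : IntegrableOn (fun r => (s * r) ^ (-(1 - β)) • R (ε + s * r)) (Set.Ioi 0) := by
      refine (integrableOn_Ioi_comp_mul_left_iff (fun t => t ^ (-(1 - β)) • R (ε + t)) 0 hs0).2 ?_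
      rwa [mul_zero]
    rw [e3, mul_smul_comm, ← integral_const_mul_of_integrable hi2, ← integral_smul]
    refine setIntegral_congr_fun measurableSet_Ioi fun r hr => ?_
    have hr0 : 0 < r := hr
    rw [smul_mul_smul_comm, smul_smul, Real.mul_rpow hs0.le hr0.le, mul_comm s r]
    congr 1
    -- The Jacobian `s` of the substitution cancels both powers of `s`, so only the weight in `r`
    -- survives.
    have : s * (s ^ (-β) * s ^ (-(1 - β))) = 1 := by
      rw [← Real.rpow_add hs0, show -β + -(1 - β) = -1 by ring, Real.rpow_neg_one,
        mul_inv_cancel₀ hs0.ne']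
    linear_combination (r ^ (-(1 - β))) * this
  rw [e1, integral_integral_swap hprod, prodConst, ← integral_smul_const]
  refine integral_congr_ae ?_
  -- The point `r = 1`, where the resolvent identity cannot be divided by `r - 1`, is a null set.
  filter_upwards [ae_restrict_mem measurableSet_Ioi, hprod.prod_left_ae,
    ae_restrict_of_ae (Measure.ae_ne volume (1 : ℝ))] with r hr hint hr1
  exact hR.integral_mul_eq hε hr hr1 hint

/-- The scalar model `D = 0`, used to read off that the constant in the product formula is nonzero.
-/
theorem isResolventFamily_inv : IsResolventFamily fun t : ℝ => t⁻¹ where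
  norm_le t ht := by rw [Real.norm_of_nonneg (by positivity)]
  sub_eq s t hs ht := by
    rw [smul_eq_mul]
    field_simp
  cancel t ht x hx := (mul_eq_zero.1 hx).resolve_left (inv_ne_zero ht.ne')

theorem prodConst_ne_zero {β : ℝ} (h0 : 0 < β) (h1 : β < 1) : prodConst β ≠ 0 := by
  intro h
  have h2 := isResolventFamily_inv.fracInt_mul_fracInt h0 h1 one_pos
  rw [h, zero_smul] at h2
  exact (mul_pos (fracConst_pos h0 h1)
    (fracConst_pos (β := 1 - β) (by linarith) (by linarith))).ne' h2

end ResolventFamily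
end KatoSum

namespace KatoSum

/-! ### The bounded quotients `(D + ε)^β (D + s)^{-β}`. -/

section Quotient

variable {𝒜 : Type*} [NormedRing 𝒜] [NormedAlgebra ℝ 𝒜]

/-- The integral `∫₀^∞ t^β R(ε + t) R(s + t) dt`. -/
noncomputable def fracDiff (R : ℝ → 𝒜) (β ε s : ℝ) : 𝒜 :=
  ∫ t in Set.Ioi (0 : ℝ), t ^ β • (R (ε + t) * R (s + t))

/-- The bounded operator `(D + ε)^β (D + s)^{-β}`. -/
noncomputable def fracQuot (R : ℝ → 𝒜) (β ε s : ℝ) : 𝒜 :=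
  1 - ((prodConst β)⁻¹ * (s - ε)) • (fracDiff R β ε s * fracInt R β s)

/-- A bound for the norm of `fracQuot R β ε s - 1`, for `ε ≤ s`. -/
noncomputable def quotConst (β : ℝ) : ℝ :=
  |prodConst β|⁻¹ * (fracConst (1 - β) * fracConst β)

theorem quotConst_nonneg (β : ℝ) : 0 ≤ quotConst β :=
  mul_nonneg (by positivity) (mul_nonneg (fracConst_nonneg _) (fracConst_nonneg _))

namespace IsResolventFamily

variable {R : ℝ → 𝒜} (hR : IsResolventFamily R)
include hR

theorem norm_fracDiff_integrand_le {β ε s t : ℝ} (hε : 0 ≤ ε) (hs : 0 < s) (ht : 0 < t) :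
    ‖t ^ β • (R (ε + t) * R (s + t))‖ ≤ t ^ (-(1 - β)) * (s + t)⁻¹ := by
  rw [norm_smul, Real.norm_of_nonneg (by positivity),
    show -(1 - β) = β - 1 by ring, Real.rpow_sub_one ht.ne', div_eq_mul_inv, mul_assoc]
  gcongr
  refine (norm_mul_le _ _).trans ?_
  gcongr
  · exact (hR.norm_le _ (by linarith)).trans (by gcongr; linarith)
  · exact hR.norm_add_le hs ht

theorem aestronglyMeasurable_fracDiff {β ε s : ℝ} (hε : 0 < ε) (hs : 0 < s) :
    AEStronglyMeasurable (fun t : ℝ => t ^ β • (R (ε + t) * R (s + t)))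
      (volume.restrict (Set.Ioi 0)) := by
  refine ContinuousOn.aestronglyMeasurable ?_ measurableSet_Ioi
  exact (continuousOn_id.rpow_const fun t ht => Or.inl (ne_of_gt ht)).smul
    ((hR.continuousOn_add hε).mul (hR.continuousOn_add hs))

theorem integrableOn_fracDiff {β ε s : ℝ} (h0 : 0 < β) (h1 : β < 1) (hε : 0 < ε) (hs : 0 < s) :
    IntegrableOn (fun t : ℝ => t ^ β • (R (ε + t) * R (s + t))) (Set.Ioi 0) := by
  refine Integrable.mono' (integrableOn_rpow_mul_inv (β := 1 - β) (by linarith) (by linarith) hs)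
    (hR.aestronglyMeasurable_fracDiff hε hs) ?_
  filter_upwards [ae_restrict_mem measurableSet_Ioi] with t ht
  exact hR.norm_fracDiff_integrand_le hε.le hs ht

theorem norm_fracDiff_le {β ε s : ℝ} (h0 : 0 < β) (h1 : β < 1) (hε : 0 < ε) (hs : 0 < s) :
    ‖fracDiff R β ε s‖ ≤ s ^ (-(1 - β)) * fracConst (1 - β) := by
  rw [← integral_rpow_mul_inv hs]
  refine norm_integral_le_of_norm_le
    (integrableOn_rpow_mul_inv (β := 1 - β) (by linarith) (by linarith) hs) ?_
  filter_upwards [ae_restrict_mem measurableSet_Ioi] with t ht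
  exact hR.norm_fracDiff_integrand_le hε.le hs ht

/-- Dominated convergence works down to `ε = 0` because `‖R(ε + t)‖ ≤ t⁻¹` turns the weight `t^β`
into the integrable singularity `t^{β-1}`. -/
theorem tendsto_fracDiff {β s : ℝ} (h0 : 0 < β) (h1 : β < 1) (hs : 0 < s) :
    Tendsto (fun ε => fracDiff R β ε s) (𝓝[>] 0) (𝓝 (fracDiff R β 0 s)) := by
  refine tendsto_integral_filter_of_dominated_convergence
    (fun t => t ^ (-(1 - β)) * (s + t)⁻¹) ?_ ?_
    (integrableOn_rpow_mul_inv (by linarith) (by linarith) hs) ?_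
  · filter_upwards [self_mem_nhdsWithin] with ε hε
    exact hR.aestronglyMeasurable_fracDiff hε hs
  · filter_upwards [self_mem_nhdsWithin] with ε hε
    filter_upwards [ae_restrict_mem measurableSet_Ioi] with t ht
    exact hR.norm_fracDiff_integrand_le (le_of_lt hε) hs ht
  · filter_upwards [ae_restrict_mem measurableSet_Ioi] with t ht
    refine Tendsto.const_smul (Tendsto.mul_const _ ?_) _
    have ht0 : 0 < t := ht
    have h : ContinuousAt R (0 + t) := by
      rw [zero_add]
      exact hR.continuousOn.continuousAt (Ioi_mem_nhds ht)
    exact (ContinuousAt.comp (f := fun ε => ε + t) h (by fun_prop)).tendsto.mono_left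
      nhdsWithin_le_nhds

theorem commute_fracDiff {β ε s : ℝ} (h0 : 0 < β) (h1 : β < 1) (hε : 0 < ε) (hs : 0 < s) {x : 𝒜}
    (hx : ∀ t, 0 < t → Commute x (R t)) : Commute x (fracDiff R β ε s) := by
  have hi := hR.integrableOn_fracDiff h0 h1 hε hs
  rw [Commute, SemiconjBy, fracDiff, ← integral_const_mul_of_integrable hi,
    ← integral_mul_const_of_integrable hi]
  refine setIntegral_congr_fun measurableSet_Ioi fun t ht => ?_
  have ht0 : 0 < t := ht
  rw [mul_smul_comm, smul_mul_assoc, ((hx _ (add_pos hε ht0)).mul_right (hx _ (add_pos hs ht0))).eq]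

/-- The factor `1 - (s - ε) R s` is `(D + ε)(D + s)⁻¹`. The integrands already agree, by the
identity `R(s + t) - (D + ε)(D + s)⁻¹ R(ε + t) = t (s - ε) R(s) R(ε + t) R(s + t)`; the extra `t`
changes the weight `t^{-(1-β)}` into `t^β`. -/
theorem fracInt_sub_eq {β ε s : ℝ} (h0 : 0 < β) (h1 : β < 1) (hε : 0 < ε) (hs : 0 < s) :
    fracInt R (1 - β) s - (1 - (s - ε) • R s) * fracInt R (1 - β) ε =
      (s - ε) • (R s * fracDiff R β ε s) := by
  have hi1 := hR.integrableOn_rpow_smul (β := 1 - β) (by linarith) (by linarith) hs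
  have hi2 := hR.integrableOn_rpow_smul (β := 1 - β) (by linarith) (by linarith) hε
  have hi3 := hR.integrableOn_fracDiff h0 h1 hε hs
  rw [fracInt, fracInt, fracDiff, ← integral_const_mul_of_integrable hi2,
    ← integral_const_mul_of_integrable hi3, ← integral_smul, ← integral_sub hi1 (hi2.const_mul _)]
  refine setIntegral_congr_fun measurableSet_Ioi fun t ht => ?_
  have ht0 : 0 < t := ht
  have e1 := hR.sub_eq _ _ hs (add_pos hs ht0)
  have e2 := hR.sub_eq _ _ hs (add_pos hε ht0)
  have e3 := hR.sub_eq _ _ (add_pos hε ht0) (add_pos hs ht0)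
  have e4 : t ^ β = t ^ (-(1 - β)) * t := by
    rw [← Real.rpow_add_one ht0.ne']
    congr 1
    ring
  rw [mul_smul_comm, ← smul_sub, mul_smul_comm, smul_smul, e4,
    show (s - ε) * (t ^ (-(1 - β)) * t) = t ^ (-(1 - β)) * (t * (s - ε)) by ring, ← smul_smul]
  congr 1
  have e5 : (s - ε) • (R s * (R (ε + t) * R (s + t))) =
      R s * R (ε + t) - R s * R (s + t) := by
    rw [← mul_smul_comm, ← mul_sub, e3]
    congr 2
    ring
  rw [mul_smul, e5, sub_mul, one_mul, smul_mul_assoc]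
  have e1' : R (s + t) = R s - t • (R s * R (s + t)) := by
    rw [eq_sub_iff_add_eq, ← eq_sub_iff_add_eq', e1]
    congr 1
    ring
  have e2' : R (ε + t) = R s - (ε + t - s) • (R s * R (ε + t)) := by
    rw [eq_sub_iff_add_eq, ← eq_sub_iff_add_eq', e2]
  generalize hX : R s * R (s + t) = X at *
  generalize hY : R s * R (ε + t) = Y at *
  rw [e1', e2']
  module

theorem resolvent_commute_fracInt {β ε s : ℝ} (h0 : 0 < β) (h1 : β < 1) (hε : 0 < ε)
    (hs : 0 < s) : Commute (R s) (fracInt R β ε) :=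
  hR.commute_fracInt h0 h1 hε fun _ ht => hR.commute hs ht

theorem fracInt_commute_fracInt {β γ ε s : ℝ} (h0 : 0 < β) (h1 : β < 1) (h0' : 0 < γ)
    (h1' : γ < 1) (hε : 0 < ε) (hs : 0 < s) : Commute (fracInt R γ s) (fracInt R β ε) :=
  hR.commute_fracInt h0 h1 hε fun _ ht => (hR.resolvent_commute_fracInt h0' h1' hs ht).symm

theorem fracInt_commute_fracDiff {β γ ε s r : ℝ} (h0 : 0 < β) (h1 : β < 1) (h0' : 0 < γ)
    (h1' : γ < 1) (hε : 0 < ε) (hs : 0 < s) (hr : 0 < r) :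
    Commute (fracInt R γ r) (fracDiff R β ε s) :=
  hR.commute_fracDiff h0 h1 hε hs fun _ ht => (hR.resolvent_commute_fracInt h0' h1' hr ht).symm

variable [CompleteSpace 𝒜]

/-- Multiplying `fracInt_sub_eq` by both integrals of exponent `β` turns each product of
complementary exponents into a resolvent. A common factor `R s` then appears on both sides and is
cancelled by injectivity. -/
theorem prodConst_smul_sub_eq {β ε s : ℝ} (h0 : 0 < β) (h1 : β < 1) (hε : 0 < ε) (hs : 0 < s) :
    prodConst β • (fracInt R β ε - fracInt R β s) =
      (s - ε) • (fracDiff R β ε s * fracInt R β s * fracInt R β ε) := by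
  have h0' : 0 < 1 - β := by linarith
  have h1' : 1 - β < 1 := by linarith
  have hs1 : fracInt R (1 - β) s * fracInt R β s = prodConst β • R s := by
    rw [(hR.fracInt_commute_fracInt h0 h1 h0' h1' hs hs).eq, hR.fracInt_mul_fracInt h0 h1 hs]
  have hε1 : fracInt R (1 - β) ε * fracInt R β ε = prodConst β • R ε := by
    rw [(hR.fracInt_commute_fracInt h0 h1 h0' h1' hε hε).eq, hR.fracInt_mul_fracInt h0 h1 hε]
  have hc := hR.fracInt_commute_fracInt h0 h1 h0 h1 hε hs
  have key := congrArg (fun x => x * (fracInt R β s * fracInt R β ε))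
    (hR.fracInt_sub_eq h0 h1 hε hs)
  have hRs : (1 - (s - ε) • R s) * R ε = R s := by
    rw [sub_mul, one_mul, smul_mul_assoc]
    have := hR.sub_eq s ε hs hε
    generalize R s * R ε = X at *
    rw [show R ε = R s - (ε - s) • X by rw [← this]; abel]
    module
  rw [sub_mul, ← mul_assoc, hs1, mul_assoc (1 - (s - ε) • R s), hc.eq,
    ← mul_assoc (fracInt R (1 - β) ε), hε1, smul_mul_assoc, smul_mul_assoc, mul_smul_comm,
    ← mul_assoc _ (R ε), hRs, ← hc.eq, smul_mul_assoc, mul_assoc (R s)] at key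
  refine sub_eq_zero.1 (hR.cancel s hs _ ?_)
  rw [mul_sub, mul_smul_comm, mul_sub, smul_sub, mul_smul_comm, key, sub_eq_zero, mul_assoc]

theorem fracQuot_mul_fracInt {β ε s : ℝ} (h0 : 0 < β) (h1 : β < 1) (hε : 0 < ε) (hs : 0 < s) :
    fracQuot R β ε s * fracInt R β ε = fracInt R β s := by
  have h := hR.prodConst_smul_sub_eq h0 h1 hε hs
  have h2 := congrArg (fun x => (prodConst β)⁻¹ • x) h
  rw [inv_smul_smul₀ (prodConst_ne_zero h0 h1), smul_smul] at h2
  rw [fracQuot, sub_mul, one_mul, smul_mul_assoc, ← h2]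
  abel

theorem fracInt_mul_fracQuot {β ε s : ℝ} (h0 : 0 < β) (h1 : β < 1) (hε : 0 < ε) (hs : 0 < s) :
    fracInt R β ε * fracQuot R β ε s = fracInt R β s := by
  rw [← hR.fracQuot_mul_fracInt h0 h1 hε hs]
  refine ((Commute.one_right _).sub_right (Commute.smul_right ?_ _)).eq
  exact (hR.fracInt_commute_fracDiff h0 h1 h0 h1 hε hs hε).mul_right
    (hR.fracInt_commute_fracInt h0 h1 h0 h1 hs hε)

-- The bound is independent of `ε` and `s`: the powers `s^{-(1-β)}` and `s^{-β}` of the two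
-- integrals cancel the prefactor `s - ε ≤ s`.
omit [CompleteSpace 𝒜] in
theorem norm_fracQuot_le {β ε s : ℝ} (h0 : 0 < β) (h1 : β < 1) (hε : 0 < ε) (hs : ε ≤ s) :
    ‖fracQuot R β ε s‖ ≤ ‖(1 : 𝒜)‖ + quotConst β := by
  have hs0 : 0 < s := hε.trans_le hs
  refine (norm_sub_le _ _).trans ?_
  gcongr
  rw [norm_smul, norm_mul, norm_inv, Real.norm_eq_abs, Real.norm_of_nonneg (by linarith),
    quotConst, mul_assoc]
  refine mul_le_mul_of_nonneg_left ?_ (by positivity)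
  calc (s - ε) * ‖fracDiff R β ε s * fracInt R β s‖
      ≤ s * ((s ^ (-(1 - β)) * fracConst (1 - β)) * (s ^ (-β) * fracConst β)) := by
        gcongr
        · linarith
        · refine (norm_mul_le _ _).trans ?_
          gcongr
          · exact mul_nonneg (by positivity) (fracConst_nonneg _)
          · exact hR.norm_fracDiff_le h0 h1 hε hs0
          · exact hR.norm_fracInt_le h0 h1 hs0
    _ = (s * (s ^ (-(1 - β)) * s ^ (-β))) * (fracConst (1 - β) * fracConst β) := by ring
    _ = fracConst (1 - β) * fracConst β := by
        rw [← Real.rpow_add hs0, show -(1 - β) + -β = -1 by ring, Real.rpow_neg_one,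
          mul_inv_cancel₀ hs0.ne', one_mul]

omit [CompleteSpace 𝒜] in
theorem tendsto_fracQuot {β s : ℝ} (h0 : 0 < β) (h1 : β < 1) (hs : 0 < s) :
    Tendsto (fun ε => fracQuot R β ε s) (𝓝[>] 0) (𝓝 (fracQuot R β 0 s)) := by
  refine tendsto_const_nhds.sub (Tendsto.smul ?_ ((hR.tendsto_fracDiff h0 h1 hs).mul_const _))
  refine Tendsto.mono_left ?_ nhdsWithin_le_nhds
  exact (by fun_prop : Continuous fun ε : ℝ => (prodConst β)⁻¹ * (s - ε)).tendsto 0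

end IsResolventFamily

end Quotient
end KatoSum

namespace KatoSum

/-! ### Resolvents, fractional powers and adjoints of m-accretive operators. -/

section Accretive

variable {E : Type*} [NormedAddCommGroup E] [InnerProductSpace ℂ E]

theorem IsResolvent.unique {T : E →ₗ.[ℂ] E} {z : ℂ} {R S : E →L[ℂ] E} (hR : IsResolvent T z R)
    (hS : IsResolvent T z S) : R = S := by
  ext f
  obtain ⟨h, hf⟩ := hR.1 f
  have := hS.2 ⟨R f, h⟩
  simp only at this
  rw [hf] at this
  exact this.symm

theorem isResolvent_resolvent {T : E →ₗ.[ℂ] E} {z : ℂ} (hz : z ∈ resolventSet T) :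
    IsResolvent T z (resolvent T z) := by
  have h : ∃ R : E →L[ℂ] E, IsResolvent T z R := hz
  rw [resolvent, dif_pos h]
  exact h.choose_spec

theorem IsResolvent.resolvent_eq {T : E →ₗ.[ℂ] E} {z : ℂ} {R : E →L[ℂ] E}
    (hR : IsResolvent T z R) : resolvent T z = R :=
  (isResolvent_resolvent ⟨R, hR⟩).unique hR

theorem IsResolvent.injective {T : E →ₗ.[ℂ] E} {z : ℂ} {R : E →L[ℂ] E}
    (hR : IsResolvent T z R) {f : E} (hf : R f = 0) : f = 0 := by
  obtain ⟨h, h2⟩ := hR.1 f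
  have h3 : (⟨R f, h⟩ : T.domain) = 0 := Subtype.ext hf
  rw [h3, LinearPMap.map_zero, hf, smul_zero, sub_zero] at h2
  exact h2.symm

/-- The first resolvent identity. -/
theorem IsResolvent.sub_eq {T : E →ₗ.[ℂ] E} {z w : ℂ} {R S : E →L[ℂ] E} (hR : IsResolvent T z R)
    (hS : IsResolvent T w S) : R - S = (z - w) • (R ∘L S) := by
  ext f
  obtain ⟨h, hf⟩ := hS.1 f
  have h1 := hR.2 ⟨S f, h⟩
  have h2 : T ⟨S f, h⟩ = f + w • S f := eq_add_of_sub_eq hf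
  simp only at h1
  rw [h2, map_sub, map_add, map_smul, map_smul] at h1
  change R f - S f = (z - w) • R (S f)
  generalize R (S f) = X at *
  rw [← h1]
  module

theorem IsMAccretive.isResolvent {T : E →ₗ.[ℂ] E} (hT : IsMAccretive T) {t : ℝ} (ht : 0 < t) :
    IsResolvent T (-(t : ℂ)) (resolvent T (-(t : ℂ))) :=
  isResolvent_resolvent (hT t (by simpa using ht)).1

theorem IsMAccretive.isResolventFamily {T : E →ₗ.[ℂ] E} (hT : IsMAccretive T) :
    IsResolventFamily fun t : ℝ => resolvent T (-(t : ℂ)) where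
  norm_le t ht := by simpa using (hT t (by simpa using ht)).2
  sub_eq s t hs ht := by
    rw [(hT.isResolvent hs).sub_eq (hT.isResolvent ht), ← Complex.coe_smul]
    push_cast
    congr 1
    ring
  cancel t ht x hx := by
    ext f
    exact (hT.isResolvent ht).injective (DFunLike.congr_fun hx f)

theorem negPow_eq (T : E →ₗ.[ℂ] E) (ε β : ℝ) : negPow T ε β =
    (Real.sin (Real.pi * β) / Real.pi) • fracInt (fun t : ℝ => resolvent T (-(t : ℂ))) β ε := by
  rw [← Complex.coe_smul]
  rfl

theorem sin_div_pi_pos {β : ℝ} (h0 : 0 < β) (h1 : β < 1) :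
    0 < Real.sin (Real.pi * β) / Real.pi :=
  div_pos (Real.sin_pos_of_pos_of_lt_pi (by positivity) (by nlinarith [Real.pi_pos])) Real.pi_pos

theorem norm_one_add_quotConst_le (β : ℝ) :
    ‖(1 : E →L[ℂ] E)‖ + quotConst β ≤ 1 + quotConst β := by
  gcongr
  exact ContinuousLinearMap.norm_id_le

/-- The constant in the bound `‖(T + ε)^{-β}‖ ≤ negPowConst β * ε^{-β}`. -/
noncomputable def negPowConst (β : ℝ) : ℝ :=
  Real.sin (Real.pi * β) / Real.pi * fracConst β

theorem IsMAccretive.norm_negPow_le {T : E →ₗ.[ℂ] E} (hT : IsMAccretive T) {β ε : ℝ} (h0 : 0 < β)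
    (h1 : β < 1) (hε : 0 < ε) : ‖negPow T ε β‖ ≤ negPowConst β * ε ^ (-β) := by
  have h := hT.isResolventFamily.norm_fracInt_le h0 h1 hε
  rw [negPow_eq, norm_smul, Real.norm_of_nonneg (sin_div_pi_pos h0 h1).le, negPowConst, mul_assoc,
    mul_comm (fracConst β)]
  exact mul_le_mul_of_nonneg_left h (sin_div_pi_pos h0 h1).le

theorem mem_fracPow_domain {T : E →ₗ.[ℂ] E} {β : ℝ} {u : E} :
    u ∈ (fracPow T β).domain ↔ ∃ v, ∃ w : ℝ → E, (∀ ε : ℝ, 0 < ε → negPow T ε β (w ε) = u) ∧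
      Tendsto w (𝓝[>] 0) (𝓝 v) := by
  rw [fracPow, Submodule.toLinearPMap_domain, Submodule.mem_map]
  constructor
  · rintro ⟨⟨u', v⟩, hp, rfl⟩
    exact ⟨v, hp⟩
  · rintro ⟨v, hp⟩
    exact ⟨(u, v), hp, rfl⟩

theorem IsMAccretive.integrableOn {T : E →ₗ.[ℂ] E} (hT : IsMAccretive T) {β ε : ℝ} (h0 : 0 < β)
    (h1 : β < 1) (hε : 0 < ε) : IntegrableOn
      (fun t : ℝ => ((t ^ (-β) : ℝ) : ℂ) • resolvent T (-((ε + t : ℝ) : ℂ))) (Set.Ioi 0) := by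
  simp only [Complex.coe_smul]
  exact hT.isResolventFamily.integrableOn_rpow_smul h0 h1 hε

variable [CompleteSpace E]

/-- `C` is `(T + ε)^β (T + s)^{-β}`. Factoring it out on either side allows the comparison to be
used for `(T + s)^{-β}` and for its adjoint alike. -/
theorem IsMAccretive.exists_negPow_quot {T : E →ₗ.[ℂ] E} (hT : IsMAccretive T) {β ε s : ℝ}
    (h0 : 0 < β) (h1 : β < 1) (hε : 0 < ε) (hs : ε ≤ s) :
    ∃ C : E →L[ℂ] E, ‖C‖ ≤ 1 + quotConst β ∧ negPow T s β = C ∘L negPow T ε β ∧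
      negPow T s β = negPow T ε β ∘L C := by
  have hR := hT.isResolventFamily
  refine ⟨_, (hR.norm_fracQuot_le h0 h1 hε hs).trans (norm_one_add_quotConst_le β), ?_, ?_⟩
  · rw [negPow_eq, negPow_eq, ← hR.fracQuot_mul_fracInt h0 h1 hε (hε.trans_le hs)]
    exact (mul_smul_comm _ _ _).symm
  · rw [negPow_eq, negPow_eq, ← hR.fracInt_mul_fracQuot h0 h1 hε (hε.trans_le hs)]
    exact (smul_mul_assoc _ _ _).symm

theorem IsMAccretive.negPow_comp_negPow {T : E →ₗ.[ℂ] E} (hT : IsMAccretive T) {β ε : ℝ}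
    (h0 : 0 < β) (h1 : β < 1) (hε : 0 < ε) :
    negPow T ε β ∘L negPow T ε (1 - β) = (Real.sin (Real.pi * β) / Real.pi *
      (Real.sin (Real.pi * (1 - β)) / Real.pi) * prodConst β) • resolvent T (-(ε : ℂ)) := by
  rw [negPow_eq, negPow_eq, ← ContinuousLinearMap.mul_def, smul_mul_smul_comm,
    hT.isResolventFamily.fracInt_mul_fracInt h0 h1 hε, smul_smul]

theorem IsMAccretive.resolvent_eq_smul_negPow_comp {T : E →ₗ.[ℂ] E} (hT : IsMAccretive T) {β ε : ℝ}
    (h0 : 0 < β) (h1 : β < 1) (hε : 0 < ε) :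
    resolvent T (-(ε : ℂ)) = (Real.sin (Real.pi * β) / Real.pi *
      (Real.sin (Real.pi * (1 - β)) / Real.pi) * prodConst β)⁻¹ •
        (negPow T ε β ∘L negPow T ε (1 - β)) := by
  rw [hT.negPow_comp_negPow h0 h1 hε, inv_smul_smul₀]
  exact mul_ne_zero (mul_pos (sin_div_pi_pos h0 h1)
    (sin_div_pi_pos (β := 1 - β) (by linarith) (by linarith))).ne' (prodConst_ne_zero h0 h1)

/-- The domain of `T^β` is the range of `(T + s)^{-β}`, for every `s > 0`. -/
theorem IsMAccretive.fracPow_domain {T : E →ₗ.[ℂ] E} (hT : IsMAccretive T) {β s : ℝ}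
    (h0 : 0 < β) (h1 : β < 1) (hs : 0 < s) :
    (fracPow T β).domain = LinearMap.range (negPow T s β : E →ₗ[ℂ] E) := by
  have hR := hT.isResolventFamily
  ext u
  rw [mem_fracPow_domain]
  constructor
  -- Membership in the domain gives a preimage under every `(T + ε)^{-β}`; `ε = s` is enough.
  · rintro ⟨v, w, hw, -⟩
    exact ⟨w s, hw s hs⟩
  · rintro ⟨g, rfl⟩
    -- For `u = (T + s)^{-β} g`, the vector `(T + ε)^β u` is the quotient applied to `g`, and the
    -- quotient converges in norm as `ε ↓ 0`.
    refine ⟨fracQuot (fun t : ℝ => resolvent T (-(t : ℂ))) β 0 s g,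
      fun ε => fracQuot (fun t : ℝ => resolvent T (-(t : ℂ))) β ε s g,
      fun ε hε => ?_, ?_⟩
    · have h := hR.fracInt_mul_fracQuot h0 h1 hε hs
      have h2 := DFunLike.congr_fun h g
      rw [negPow_eq, negPow_eq]
      exact congrArg _ h2
    · exact ((ContinuousLinearMap.apply ℂ E g).continuous.tendsto _).comp
        (hR.tendsto_fracQuot h0 h1 hs)

local notation "⟪" x ", " y "⟫" => inner ℂ x y

-- The resolvent bound on the positive axis says `t ‖u‖ ≤ ‖(T + t) u‖`. After squaring, the terms in
-- `t²` cancel, and a negative real part would be contradicted for large `t`.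
omit [CompleteSpace E] in
theorem IsMAccretive.re_inner_nonneg {T : E →ₗ.[ℂ] E} (hT : IsMAccretive T) (u : T.domain) :
    0 ≤ (⟪T u, (u : E)⟫).re := by
  have key : ∀ t : ℝ, 0 < t → 0 ≤ ‖T u‖ ^ 2 + 2 * t * (⟪T u, (u : E)⟫).re := by
    intro t ht
    have h1 := (hT.isResolvent ht).2 u
    have h2 : t * ‖(u : E)‖ ≤ ‖T u - (-(t : ℂ)) • (u : E)‖ := by
      have := (resolvent T (-(t : ℂ))).le_opNorm (T u - (-(t : ℂ)) • (u : E))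
      rw [h1] at this
      have h3 := hT.isResolventFamily.norm_le t ht
      have h4 := this.trans (mul_le_mul_of_nonneg_right h3 (norm_nonneg _))
      rwa [inv_mul_eq_div, le_div_iff₀ ht, mul_comm] at h4
    rw [neg_smul, sub_neg_eq_add] at h2
    have h3 := pow_le_pow_left₀ (by positivity) h2 2
    rw [@norm_add_sq ℂ, inner_smul_right, norm_smul, Complex.norm_real,
      Real.norm_of_nonneg ht.le] at h3
    simp only [RCLike.re_to_complex, Complex.re_ofReal_mul] at h3
    linarith
  by_contra! hneg
  obtain ⟨t, ht⟩ := exists_gt (max 0 (‖T u‖ ^ 2 / (-2 * (⟪T u, (u : E)⟫).re)))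
  have h0 : 0 < t := (le_max_left _ _).trans_lt ht
  have h1 := (le_max_right _ _).trans_lt ht
  rw [div_lt_iff₀ (by linarith)] at h1
  have := key t h0
  nlinarith

/-- For `f` orthogonal to the domain and `u = (T + 1)⁻¹ f`, one has `T u = f - u`, so accretivity
gives `-‖u‖² ≥ 0`; hence `u = 0` and `f = 0`. This supplies the density of the domain of `katoSum`,
which its definition does not provide. -/
theorem IsMAccretive.dense_domain {T : E →ₗ.[ℂ] E} (hT : IsMAccretive T) :
    Dense (T.domain : Set E) := by
  rw [Submodule.dense_iff_topologicalClosure_eq_top,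
    Submodule.topologicalClosure_eq_top_iff, Submodule.eq_bot_iff]
  intro f hf
  obtain ⟨h, h2⟩ := (hT.isResolvent one_pos).1 f
  have h3 := (Submodule.mem_orthogonal' _ _).1 hf _ h
  have h4 := hT.re_inner_nonneg ⟨_, h⟩
  have h5 : T ⟨_, h⟩ = f - resolvent T (-((1 : ℝ) : ℂ)) f := by
    nth_rewrite 2 [← h2]
    simp
  rw [h5, inner_sub_left, h3, zero_sub, Complex.neg_re, ← RCLike.re_to_complex,
    inner_self_eq_norm_sq] at h4
  have h6 : ‖resolvent T (-((1 : ℝ) : ℂ)) f‖ = 0 := by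
    nlinarith [norm_nonneg (resolvent T (-((1 : ℝ) : ℂ)) f)]
  exact (hT.isResolvent one_pos).injective (norm_eq_zero.1 h6)

theorem IsResolvent.adjoint {T : E →ₗ.[ℂ] E} (hd : Dense (T.domain : Set E)) {z : ℂ}
    {R : E →L[ℂ] E} (hR : IsResolvent T z R) :
    IsResolvent T.adjoint (starRingEnd ℂ z) (ContinuousLinearMap.adjoint R) := by
  have key : ∀ (f : E) (x : T.domain),
      ⟪f + starRingEnd ℂ z • ContinuousLinearMap.adjoint R f, (x : E)⟫ =
        ⟪ContinuousLinearMap.adjoint R f, T x⟫ := by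
    intro f x
    have h1 := hR.2 x
    rw [map_sub, map_smul, sub_eq_iff_eq_add] at h1
    rw [ContinuousLinearMap.adjoint_inner_left, h1, inner_add_left, inner_smul_left,
      ContinuousLinearMap.adjoint_inner_left, inner_add_right, inner_smul_right, Complex.conj_conj]
  constructor
  · intro f
    have hm : ContinuousLinearMap.adjoint R f ∈ T.adjoint.domain :=
      LinearPMap.mem_adjoint_domain_of_exists _ ⟨_, key f⟩
    refine ⟨hm, ?_⟩
    rw [LinearPMap.adjoint_apply_eq hd ⟨_, hm⟩ (key f), add_sub_cancel_right]
  · intro u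
    refine ext_inner_right ℂ fun f => ?_
    obtain ⟨h, h2⟩ := hR.1 f
    have h3 := LinearPMap.adjoint_isFormalAdjoint hd u ⟨_, h⟩
    simp only at h3
    rw [ContinuousLinearMap.adjoint_inner_left, inner_sub_left, inner_smul_left,
      Complex.conj_conj, h3]
    nth_rewrite 3 [← h2]
    rw [inner_sub_right, inner_smul_right]

theorem resolvent_adjoint {T : E →ₗ.[ℂ] E} (hd : Dense (T.domain : Set E)) {z : ℂ}
    (hz : z ∈ resolventSet T) : resolvent T.adjoint (starRingEnd ℂ z) =
      ContinuousLinearMap.adjoint (resolvent T z) :=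
  ((isResolvent_resolvent hz).adjoint hd).resolvent_eq

theorem IsMAccretive.adjoint {T : E →ₗ.[ℂ] E} (hT : IsMAccretive T) :
    IsMAccretive T.adjoint := by
  intro ζ hζ
  obtain ⟨h1, h2⟩ := hT (starRingEnd ℂ ζ) (by simpa using hζ)
  have h3 := (isResolvent_resolvent h1).adjoint hT.dense_domain
  have h4 := h3.resolvent_eq
  rw [map_neg, Complex.conj_conj] at h3 h4
  refine ⟨⟨_, h3⟩, ?_⟩
  rw [h4, LinearIsometryEquiv.norm_map]
  simpa using h2

/-- Passing to matrix elements reduces statements about the operator integral, such as the formula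
for its adjoint, to scalar integrals, where conjugation commutes with integration. -/
theorem IsMAccretive.inner_negPow {T : E →ₗ.[ℂ] E} (hT : IsMAccretive T) {β ε : ℝ} (h0 : 0 < β)
    (h1 : β < 1) (hε : 0 < ε) (f g : E) : ⟪g, negPow T ε β f⟫ =
      ((Real.sin (Real.pi * β) / Real.pi : ℝ) : ℂ) * ∫ t in Set.Ioi (0 : ℝ),
        ((t ^ (-β) : ℝ) : ℂ) * ⟪g, resolvent T (-((ε + t : ℝ) : ℂ)) f⟫ := by
  have h := ContinuousLinearMap.integral_comp_comm
    ((innerSL ℂ g) ∘L (ContinuousLinearMap.apply ℂ E f)) (hT.integrableOn h0 h1 hε)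
  rw [negPow, smul_apply, inner_smul_right]
  congr 1
  refine Eq.trans h.symm ?_
  refine setIntegral_congr_fun measurableSet_Ioi fun t _ => ?_
  exact inner_smul_right _ _ _

theorem IsMAccretive.inner_negPow_sub {T S : E →ₗ.[ℂ] E} (hT : IsMAccretive T)
    (hS : IsMAccretive S) {β ε : ℝ} (h0 : 0 < β) (h1 : β < 1) (hε : 0 < ε) (f g : E) :
    ⟪g, (negPow T ε β - negPow S ε β) f⟫ =
      ((Real.sin (Real.pi * β) / Real.pi : ℝ) : ℂ) * ∫ t in Set.Ioi (0 : ℝ),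
        ((t ^ (-β) : ℝ) : ℂ) * ⟪g, (resolvent T (-((ε + t : ℝ) : ℂ)) -
          resolvent S (-((ε + t : ℝ) : ℂ))) f⟫ := by
  have h := ContinuousLinearMap.integral_comp_comm
    ((innerSL ℂ g) ∘L (ContinuousLinearMap.apply ℂ E f))
    ((hT.integrableOn h0 h1 hε).sub (hS.integrableOn h0 h1 hε))
  rw [negPow, negPow, ← smul_sub, ← integral_sub (hT.integrableOn h0 h1 hε)
    (hS.integrableOn h0 h1 hε), smul_apply, inner_smul_right]
  congr 1
  refine Eq.trans h.symm ?_
  refine setIntegral_congr_fun measurableSet_Ioi fun t _ => ?_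
  change ⟪g, (((t ^ (-β) : ℝ) : ℂ) • resolvent T (-((ε + t : ℝ) : ℂ)) -
    ((t ^ (-β) : ℝ) : ℂ) • resolvent S (-((ε + t : ℝ) : ℂ))) f⟫ = _
  rw [← smul_sub]
  exact inner_smul_right _ _ _

theorem IsMAccretive.negPow_adjoint {T : E →ₗ.[ℂ] E} (hT : IsMAccretive T) {β ε : ℝ} (h0 : 0 < β)
    (h1 : β < 1) (hε : 0 < ε) :
    negPow T.adjoint ε β = ContinuousLinearMap.adjoint (negPow T ε β) := by
  refine ContinuousLinearMap.ext fun f => ext_inner_left ℂ fun g => ?_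
  rw [ContinuousLinearMap.adjoint_inner_right, ← inner_conj_symm (𝕜 := ℂ) _ f,
    hT.adjoint.inner_negPow h0 h1 hε, hT.inner_negPow h0 h1 hε, map_mul, Complex.conj_ofReal,
    ← integral_conj]
  congr 1
  refine setIntegral_congr_fun measurableSet_Ioi fun t ht => ?_
  have hz := (hT (ε + t : ℝ) (by simpa using add_pos hε ht)).1
  have h2 := resolvent_adjoint hT.dense_domain hz
  rw [map_neg, Complex.conj_ofReal] at h2
  rw [h2, map_mul, Complex.conj_ofReal, inner_conj_symm, ContinuousLinearMap.adjoint_inner_right]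

end Accretive

/-! ### Comparison of ranges of adjoints by norm inequalities. -/

section Range

variable {E F : Type*} [NormedAddCommGroup E] [InnerProductSpace ℂ E] [CompleteSpace E]
  [NormedAddCommGroup F] [InnerProductSpace ℂ F] [CompleteSpace F]

local notation "⟪" x ", " y "⟫" => inner ℂ x y

/-- A vector that is dominated by `S` is in the range of the adjoint of `S`. -/
theorem mem_range_adjoint_of_bound (S : E →L[ℂ] F) (u : E) (C : ℝ)
    (h : ∀ f, ‖⟪u, f⟫‖ ≤ C * ‖S f‖) : ∃ v, ContinuousLinearMap.adjoint S v = u := by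
  let S' : E →ₗ[ℂ] F := S
  have hker : LinearMap.ker S' ≤ LinearMap.ker (innerSL ℂ u : E →ₗ[ℂ] ℂ) := by
    intro f hf
    have hf' : S f = 0 := hf
    have := h f
    rw [hf', norm_zero, mul_zero] at this
    exact norm_le_zero_iff.1 this
  -- The functional `S f ↦ ⟪u, f⟫` is well defined and bounded on the range of `S`. Its Hahn–Banach
  -- extension is represented by a vector `v` through the Riesz theorem, and then `S* v = u`.
  let φ : LinearMap.range S' →ₗ[ℂ] ℂ :=
    (Submodule.liftQ _ (innerSL ℂ u : E →ₗ[ℂ] ℂ) hker) ∘ₗ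
      (S'.quotKerEquivRange.symm : LinearMap.range S' →ₗ[ℂ] (E ⧸ LinearMap.ker S'))
  have hφ : ∀ f, φ ⟨S' f, LinearMap.mem_range_self S' f⟩ = ⟪u, f⟫ := by
    intro f
    have h2 : S'.quotKerEquivRange.symm ⟨S' f, LinearMap.mem_range_self S' f⟩ =
        Submodule.Quotient.mk f := by
      rw [LinearEquiv.symm_apply_eq]
      rfl
    simp only [φ, LinearMap.comp_apply, LinearEquiv.coe_coe]
    rw [h2]
    rfl
  let φ' : StrongDual ℂ (LinearMap.range S') := φ.mkContinuous C (by
    rintro ⟨_, f, rfl⟩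
    rw [hφ]
    exact h f)
  obtain ⟨ψ, hψ, -⟩ := exists_extension_norm_eq (LinearMap.range S') φ'
  refine ⟨(InnerProductSpace.toDual ℂ F).symm ψ, ext_inner_right ℂ fun f => ?_⟩
  rw [ContinuousLinearMap.adjoint_inner_left, InnerProductSpace.toDual_symm_apply, ← hφ f]
  exact hψ ⟨S' f, LinearMap.mem_range_self S' f⟩

theorem range_adjoint_le_of_norm_le (S T : E →L[ℂ] F) (C : ℝ) (h : ∀ f, ‖S f‖ ≤ C * ‖T f‖) :
    LinearMap.range (ContinuousLinearMap.adjoint S : F →ₗ[ℂ] E) ≤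
      LinearMap.range (ContinuousLinearMap.adjoint T : F →ₗ[ℂ] E) := by
  rintro _ ⟨v, rfl⟩
  refine mem_range_adjoint_of_bound T _ (‖v‖ * C) fun f => ?_
  change ‖⟪ContinuousLinearMap.adjoint S v, f⟫‖ ≤ _
  rw [ContinuousLinearMap.adjoint_inner_left, mul_assoc]
  exact (norm_inner_le_norm _ _).trans (mul_le_mul_of_nonneg_left (h f) (norm_nonneg _))

/-- Adjoints of relatively bounded perturbations, with bound less than one, have the same range. -/
theorem range_adjoint_eq_of_norm_sub_le (S T : E →L[ℂ] F) {κ : ℝ} (hκ : κ < 1)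
    (h : ∀ f, ‖(S - T) f‖ ≤ κ * ‖T f‖) :
    LinearMap.range (ContinuousLinearMap.adjoint S : F →ₗ[ℂ] E) =
      LinearMap.range (ContinuousLinearMap.adjoint T : F →ₗ[ℂ] E) := by
  refine le_antisymm (range_adjoint_le_of_norm_le S T (1 + κ) fun f => ?_)
    (range_adjoint_le_of_norm_le T S (1 - κ)⁻¹ fun f => ?_)
  · have h1 := h f
    have h2 := norm_sub_norm_le (S f) (T f)
    rw [sub_apply] at h1
    linarith
  · have h1 := h f
    have h2 := norm_sub_norm_le (T f) (S f)
    rw [sub_apply, norm_sub_rev] at h1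
    rw [inv_mul_eq_div, le_div_iff₀ (by linarith)]
    linarith

end Range
end KatoSum

namespace KatoSum

/-! ### Bounded closures of the products `A L` and `L B*`. -/

section Closure

variable {E F G : Type*} [NormedAddCommGroup E] [InnerProductSpace ℂ E]
  [NormedAddCommGroup F] [InnerProductSpace ℂ F] [NormedAddCommGroup G] [InnerProductSpace ℂ G]

local notation "⟪" x ", " y "⟫" => inner ℂ x y

theorem mem_prod_domain {S : F →ₗ.[ℂ] G} {T : E →ₗ.[ℂ] F} {x : E} :
    x ∈ (prod S T).domain ↔ ∃ h : x ∈ T.domain, T ⟨x, h⟩ ∈ S.domain := by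
  constructor
  · rintro ⟨y, hy, rfl⟩
    exact ⟨y.2, hy⟩
  · rintro ⟨h, h2⟩
    exact ⟨⟨x, h⟩, h2, rfl⟩

theorem isBddExt_bddClosure {S : E →ₗ.[ℂ] F} {L : E →L[ℂ] F} (h : IsBddExt S L) :
    IsBddExt S (bddClosure S) := by
  have h' : ∃ L : E →L[ℂ] F, IsBddExt S L := ⟨L, h⟩
  rw [bddClosure, dif_pos h']
  exact h'.choose_spec

theorem ext_of_dense {D : Submodule ℂ E} (hD : Dense (D : Set E)) {L M : E →L[ℂ] F}
    (h : ∀ x ∈ D, L x = M x) : L = M :=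
  ContinuousLinearMap.ext fun x =>
    congrFun (L.continuous.ext_on hD M.continuous fun x hx => h x hx) x

/-- The product `A L` is closed, as the preimage of the graph of `A` shows, and everywhere defined,
so the closed graph theorem applies. -/
theorem exists_clm_of_closed [CompleteSpace F] [CompleteSpace G] {A : E →ₗ.[ℂ] F}
    (hA : A.IsClosed) (L : G →L[ℂ] E) (hL : ∀ f, L f ∈ A.domain) :
    ∃ Q : G →L[ℂ] F, ∀ f, Q f = A ⟨L f, hL f⟩ := by
  let Q : G →ₗ[ℂ] F := A.toFun ∘ₗ (L : G →ₗ[ℂ] E).codRestrict A.domain hL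
  have hQ : ∀ f, Q f = A ⟨L f, hL f⟩ := fun f => rfl
  have hcl : _root_.IsClosed (Q.graph : Set (G × F)) := by
    have h : (Q.graph : Set (G × F)) = (fun p : G × F => (L p.1, p.2)) ⁻¹' A.graph := by
      ext ⟨f, y⟩
      simp only [SetLike.mem_coe, LinearMap.mem_graph_iff, Set.mem_preimage,
        LinearPMap.mem_graph_iff]
      constructor
      · rintro rfl
        exact ⟨⟨L f, hL f⟩, rfl, rfl⟩
      · rintro ⟨⟨x, hx⟩, rfl, h2⟩
        exact h2.symm
    rw [h]
    exact IsClosed.preimage (by fun_prop) hA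
  exact ⟨ContinuousLinearMap.ofIsClosedGraph hcl, hQ⟩

variable [CompleteSpace E] [CompleteSpace F]

/-- The adjoint of a closed operator is densely defined. -/
theorem dense_adjoint_domain {B : E →ₗ.[ℂ] F} (hB : B.IsClosed) :
    Dense (B.adjoint.domain : Set F) := by
  rw [Submodule.dense_iff_topologicalClosure_eq_top,
    Submodule.topologicalClosure_eq_top_iff, Submodule.eq_bot_iff]
  intro g hg
  -- The graph is moved to the Hilbert sum, where orthogonality makes sense. The complement of the
  -- graph consists of pairs `(-B* y, y)`, so a `g` orthogonal to the domain of `B*` puts `(0, g)`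
  -- into the double complement, which is the graph itself.
  let Γ : Submodule ℂ (WithLp 2 (E × F)) :=
    B.graph.comap (WithLp.linearEquiv 2 ℂ (E × F) : WithLp 2 (E × F) →ₗ[ℂ] E × F)
  have hcl : _root_.IsClosed (Γ : Set (WithLp 2 (E × F))) :=
    IsClosed.preimage (WithLp.prod_continuous_ofLp 2 E F) hB
  have hΓ : Γ.orthogonal.orthogonal = Γ := by
    rw [Submodule.orthogonal_orthogonal_eq_closure, hcl.submodule_topologicalClosure_eq]
  have hmem : WithLp.toLp 2 ((0 : E), g) ∈ Γ := by
    rw [← hΓ, Submodule.mem_orthogonal]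
    intro p hp
    rw [Submodule.mem_orthogonal] at hp
    have hp2 : p.snd ∈ B.adjoint.domain := by
      refine LinearPMap.mem_adjoint_domain_of_exists _ ⟨-p.fst, fun x => ?_⟩
      have h1 := hp (WithLp.toLp 2 ((x : E), B x)) (B.mem_graph x)
      rw [WithLp.prod_inner_apply] at h1
      have h2 : ⟪(x : E), p.fst⟫ + ⟪B x, p.snd⟫ = 0 := h1
      rw [inner_neg_left, ← inner_conj_symm, ← inner_conj_symm p.snd, neg_eq_iff_add_eq_zero,
        ← map_add, h2, map_zero]
    have h3 := (Submodule.mem_orthogonal _ _).1 hg _ hp2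
    rw [WithLp.prod_inner_apply]
    change ⟪p.fst, (0 : E)⟫ + ⟪p.snd, g⟫ = 0
    rw [h3, inner_zero_right, add_zero]
  have h4 : ((0 : E), g) ∈ B.graph := hmem
  exact B.graph_fst_eq_zero_snd h4 rfl

theorem bddClosure_prod_ofCLM_apply {A : E →ₗ.[ℂ] F} (hA : A.IsClosed) (L : E →L[ℂ] E)
    (hL : ∀ f, L f ∈ A.domain) (f : E) :
    bddClosure (prod A (ofCLM L)) f = A ⟨L f, hL f⟩ := by
  obtain ⟨Q, hQ⟩ := exists_clm_of_closed hA L hL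
  have h1 : IsBddExt (prod A (ofCLM L)) Q := fun x => hQ x
  exact isBddExt_bddClosure h1 ⟨f, mem_prod_domain.2 ⟨Submodule.mem_top, hL f⟩⟩

theorem bddClosure_prod_ofCLM_comp {A : E →ₗ.[ℂ] F} (hA : A.IsClosed) {L M C : E →L[ℂ] E}
    (hL : ∀ f, L f ∈ A.domain) (hM : M = L ∘L C) :
    bddClosure (prod A (ofCLM M)) = bddClosure (prod A (ofCLM L)) ∘L C := by
  subst hM
  ext f
  exact (bddClosure_prod_ofCLM_apply hA _ (fun f => hL (C f)) f).trans
    (bddClosure_prod_ofCLM_apply hA _ hL (C f)).symm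

/-- `L B*` is contained in the adjoint of `B L*`, and `B L*` is bounded by the closed graph theorem.
-/
theorem bddClosure_ofCLM_prod_adjoint_apply {B : E →ₗ.[ℂ] F} (hd : Dense (B.domain : Set E))
    (hB : B.IsClosed) (L : E →L[ℂ] E) (hL : ∀ f, ContinuousLinearMap.adjoint L f ∈ B.domain)
    (y : B.adjoint.domain) :
    bddClosure (prod (ofCLM L) B.adjoint) (y : F) = L (B.adjoint y) := by
  obtain ⟨Q, hQ⟩ := exists_clm_of_closed hB _ hL
  have h1 : IsBddExt (prod (ofCLM L) B.adjoint) (ContinuousLinearMap.adjoint Q) := by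
    intro x
    obtain ⟨h, -⟩ := mem_prod_domain.1 x.2
    change ContinuousLinearMap.adjoint Q x = L (B.adjoint ⟨x, h⟩)
    refine ext_inner_right ℂ fun f => ?_
    rw [ContinuousLinearMap.adjoint_inner_left, hQ, ← ContinuousLinearMap.adjoint_inner_right,
      LinearPMap.adjoint_isFormalAdjoint hd ⟨x, h⟩ ⟨_, hL f⟩]
  exact isBddExt_bddClosure h1 ⟨y, mem_prod_domain.2 ⟨y.2, Submodule.mem_top⟩⟩

theorem bddClosure_comp_ofCLM_prod_adjoint {B : E →ₗ.[ℂ] F} (hd : Dense (B.domain : Set E))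
    (hB : B.IsClosed) {L M C : E →L[ℂ] E} (hL : ∀ f, ContinuousLinearMap.adjoint L f ∈ B.domain)
    (hM : M = C ∘L L) :
    bddClosure (prod (ofCLM M) B.adjoint) = C ∘L bddClosure (prod (ofCLM L) B.adjoint) := by
  subst hM
  have hL' : ∀ f, ContinuousLinearMap.adjoint (C ∘L L) f ∈ B.domain := by
    intro f
    rw [ContinuousLinearMap.adjoint_comp]
    exact hL _
  refine ext_of_dense (dense_adjoint_domain hB) fun y hy => ?_
  rw [bddClosure_ofCLM_prod_adjoint_apply hd hB _ hL' ⟨y, hy⟩, ContinuousLinearMap.comp_apply,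
    ContinuousLinearMap.comp_apply, bddClosure_ofCLM_prod_adjoint_apply hd hB _ hL ⟨y, hy⟩]

end Closure

/-! ### Kato's resolvent formula for the generalized sum. -/

section Kato

variable {H K : Type*} [NormedAddCommGroup H] [InnerProductSpace ℂ H] [CompleteSpace H]
  [NormedAddCommGroup K] [InnerProductSpace ℂ K] [CompleteSpace K]
  {T₀ : H →ₗ.[ℂ] H} {A B : H →ₗ.[ℂ] K}

namespace Hypotheses

variable (hyp : Hypotheses T₀ A B)
include hyp

omit [CompleteSpace K] in
theorem resolvent_mem_domain {z : ℂ} (hz : z ∈ resolventSet T₀) (f : H) :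
    resolvent T₀ z f ∈ A.domain :=
  hyp.dom_A ((isResolvent_resolvent hz).1 f).1

omit [CompleteSpace K] in
theorem adjoint_resolvent_mem_domain {z : ℂ} (hz : z ∈ resolventSet T₀) (f : H) :
    ContinuousLinearMap.adjoint (resolvent T₀ z) f ∈ B.domain :=
  hyp.dom_B (((isResolvent_resolvent hz).adjoint hyp.dense_T₀).1 f).1

theorem bddClosure_right_apply {z : ℂ} (hz : z ∈ resolventSet T₀) (y : B.adjoint.domain) :
    bddClosure (prod (ofCLM (resolvent T₀ z)) B.adjoint) (y : K) =
      resolvent T₀ z (B.adjoint y) :=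
  bddClosure_ofCLM_prod_adjoint_apply hyp.dense_B hyp.closed_B _
    (hyp.adjoint_resolvent_mem_domain hz) y

theorem bddClosure_left_apply {z : ℂ} (hz : z ∈ resolventSet T₀) (f : H) :
    bddClosure (prod A (ofCLM (resolvent T₀ z))) f =
      A ⟨resolvent T₀ z f, hyp.resolvent_mem_domain hz f⟩ :=
  bddClosure_prod_ofCLM_apply hyp.closed_A _ (hyp.resolvent_mem_domain hz) f

theorem isBddExt_birmanSchwingerMin_iff {z : ℂ} (hz : z ∈ resolventSet T₀) {L : K →L[ℂ] K} :
    IsBddExt (birmanSchwingerMin T₀ A B z) L ↔ ∀ y : B.adjoint.domain,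
      L y = -bddClosure (prod A (ofCLM (resolvent T₀ z))) (B.adjoint y) := by
  have key : ∀ (x : (birmanSchwingerMin T₀ A B z).domain) (h : (x : K) ∈ B.adjoint.domain),
      birmanSchwingerMin T₀ A B z x =
        -bddClosure (prod A (ofCLM (resolvent T₀ z))) (B.adjoint ⟨x, h⟩) := by
    intro x h
    rw [hyp.bddClosure_left_apply hz]
    rfl
  constructor
  · intro h y
    have hm : (y : K) ∈ (birmanSchwingerMin T₀ A B z).domain :=
      mem_prod_domain.2 ⟨mem_prod_domain.2 ⟨y.2, Submodule.mem_top⟩,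
        hyp.resolvent_mem_domain hz _⟩
    exact (h ⟨y, hm⟩).trans (key ⟨y, hm⟩ y.2)
  · intro h x
    obtain ⟨hx, -⟩ := mem_prod_domain.1 x.2
    obtain ⟨hx, -⟩ := mem_prod_domain.1 hx
    rw [key x hx]
    exact h ⟨x, hx⟩

/-- Boundedness at one point `w` spreads to every `z` in the resolvent set: by the resolvent
identity `K(z)` differs from `K(w)` by `(z - w)` times the bounded product of `A (T₀ - z)⁻¹` and the
closure of `(T₀ - w)⁻¹ B*`. -/
theorem birmanSchwinger_apply {z : ℂ} (hz : z ∈ resolventSet T₀) (y : B.adjoint.domain) :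
    birmanSchwinger T₀ A B z y =
      -bddClosure (prod A (ofCLM (resolvent T₀ z))) (B.adjoint y) := by
  obtain ⟨w, hw, L, hL⟩ := hyp.bdd
  rw [hyp.isBddExt_birmanSchwingerMin_iff hw] at hL
  have h : IsBddExt (birmanSchwingerMin T₀ A B z)
      (L - (z - w) • (bddClosure (prod A (ofCLM (resolvent T₀ z))) ∘L
        bddClosure (prod (ofCLM (resolvent T₀ w)) B.adjoint))) := by
    rw [hyp.isBddExt_birmanSchwingerMin_iff hz]
    intro y
    have h1 := (isResolvent_resolvent hz).sub_eq (isResolvent_resolvent hw)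
    have h2 := DFunLike.congr_fun h1 (B.adjoint y)
    have h3 : resolvent T₀ z (B.adjoint y) = resolvent T₀ w (B.adjoint y) +
        (z - w) • resolvent T₀ z (resolvent T₀ w (B.adjoint y)) := by
      rw [← sub_eq_iff_eq_add']
      exact h2
    rw [sub_apply, smul_apply, ContinuousLinearMap.comp_apply, hL,
      hyp.bddClosure_right_apply hw, hyp.bddClosure_left_apply hz, hyp.bddClosure_left_apply hz,
      hyp.bddClosure_left_apply hw]
    have h4 : A ⟨resolvent T₀ z (B.adjoint y), hyp.resolvent_mem_domain hz _⟩ =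
        A (⟨resolvent T₀ w (B.adjoint y), hyp.resolvent_mem_domain hw _⟩ +
          (z - w) • ⟨resolvent T₀ z (resolvent T₀ w (B.adjoint y)),
            hyp.resolvent_mem_domain hz _⟩) := by
      congr 1
      exact Subtype.ext h3
    rw [h4, LinearPMap.map_add, LinearPMap.map_smul]
    abel
  exact (hyp.isBddExt_birmanSchwingerMin_iff hz).1 (isBddExt_bddClosure h) y

/-- On the domain of `B*` this is the definition of `K(z)`. Since that domain is dense and `A` is
closed, it extends to all `g`. -/
theorem mem_graph {z : ℂ} (hz : z ∈ resolventSet T₀) (g : K) :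
    (bddClosure (prod (ofCLM (resolvent T₀ z)) B.adjoint) g, -birmanSchwinger T₀ A B z g) ∈
      A.graph := by
  have hcl : _root_.IsClosed {g : K | (bddClosure (prod (ofCLM (resolvent T₀ z)) B.adjoint) g,
      -birmanSchwinger T₀ A B z g) ∈ A.graph} := by
    have hc : Continuous fun g : K => (bddClosure (prod (ofCLM (resolvent T₀ z)) B.adjoint) g,
      -birmanSchwinger T₀ A B z g) := by fun_prop
    exact IsClosed.preimage hc hyp.closed_A
  refine (dense_adjoint_domain hyp.closed_B).induction
    (P := fun g => (bddClosure (prod (ofCLM (resolvent T₀ z)) B.adjoint) g,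
      -birmanSchwinger T₀ A B z g) ∈ A.graph) (fun y hy => ?_) hcl g
  rw [hyp.bddClosure_right_apply hz ⟨y, hy⟩, hyp.birmanSchwinger_apply hz ⟨y, hy⟩, neg_neg,
    hyp.bddClosure_left_apply hz]
  exact A.mem_graph ⟨_, _⟩

/-- With `Q = A (T₀ - z)⁻¹` and `g = [1 - K(z)]⁻¹ Q f`, the assumption says that `(T₀ - z)⁻¹ f` is
the closure of `(T₀ - z)⁻¹ B*` applied to `g`. Applying `A` gives `Q f = -K(z) g`, while `Q f = g -
K(z) g` by the choice of `g`; so `g = 0`, and then `f = 0`. -/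
theorem katoResolvent_injective {z : ℂ} (hz : z ∈ admissible T₀ A B) {f : H}
    (hf : katoResolvent T₀ A B z f = 0) : f = 0 := by
  obtain ⟨hz, h1⟩ := hz
  have hu : IsUnit (1 - birmanSchwinger T₀ A B z) := by
    simpa [spectrum.mem_resolventSet_iff] using h1
  set Q := bddClosure (prod A (ofCLM (resolvent T₀ z))) with hQ
  set P := bddClosure (prod (ofCLM (resolvent T₀ z)) B.adjoint) with hP
  set g := Ring.inverse (1 - birmanSchwinger T₀ A B z) (Q f) with hg
  have h2 : resolvent T₀ z f = P g := sub_eq_zero.1 hf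
  have h3 : Q f = -birmanSchwinger T₀ A B z g := by
    have h4 := hyp.mem_graph hz g
    have h5 : (resolvent T₀ z f, Q f) ∈ A.graph := by
      rw [hQ, hyp.bddClosure_left_apply hz]
      exact A.mem_graph ⟨_, _⟩
    rw [h2] at h5
    exact A.mem_graph_snd_inj h5 h4 rfl
  have h4 : Q f = g - birmanSchwinger T₀ A B z g := by
    have := DFunLike.congr_fun (Ring.mul_inverse_cancel _ hu) (Q f)
    exact this.symm
  have h5 : g = 0 := by
    rw [← sub_add_cancel g (birmanSchwinger T₀ A B z g), ← h4, h3, neg_add_cancel]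
  rw [h5, map_zero] at h2
  exact (isResolvent_resolvent hz).injective h2

/-- `toLinearPMap` has the prescribed graph only if that graph is single-valued, which follows from
injectivity of `katoResolvent` at one admissible point. -/
theorem katoSum_graph : (katoSum T₀ A B).graph = katoGraph T₀ A B := by
  refine Submodule.toLinearPMap_graph_eq _ ?_
  rintro ⟨u, v⟩ hp (rfl : u = 0)
  obtain ⟨z, hz⟩ := hyp.admissible_nonempty
  have h := hp z hz
  simp only [smul_zero, sub_zero] at h
  exact hyp.katoResolvent_injective hz h

/-- The resolvent of the generalized sum is given by Kato's formula. -/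
theorem resolvent_katoSum {z : ℂ} (hz : z ∈ admissible T₀ A B)
    (hz' : z ∈ resolventSet (katoSum T₀ A B)) :
    resolvent (katoSum T₀ A B) z = katoResolvent T₀ A B z := by
  ext f
  obtain ⟨h, h2⟩ := (isResolvent_resolvent hz').1 f
  have h3 := (katoSum T₀ A B).mem_graph ⟨_, h⟩
  rw [hyp.katoSum_graph] at h3
  have h4 := h3 z hz
  simp only at h4
  rw [h2] at h4
  exact h4.symm

end Hypotheses

end Kato
end KatoSum

namespace KatoSum

/-! ### Resolvent difference estimates and the relative bound. -/

section Estimates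

variable {H K : Type*} [NormedAddCommGroup H] [InnerProductSpace ℂ H] [CompleteSpace H]
  [NormedAddCommGroup K] [InnerProductSpace ℂ K] [CompleteSpace K]
  {T₀ : H →ₗ.[ℂ] H} {A B : H →ₗ.[ℂ] K}

local notation "⟪" x ", " y "⟫" => inner ℂ x y

theorem norm_le_of_inner_le {E : Type*} [NormedAddCommGroup E] [InnerProductSpace ℂ E] {x : E}
    {M : ℝ} (hM : 0 ≤ M) (h : ∀ f : E, ‖⟪x, f⟫‖ ≤ M * ‖f‖) : ‖x‖ ≤ M := by
  rw [← innerSL_apply_norm ℂ x]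
  exact ContinuousLinearMap.opNorm_le_bound _ hM h

theorem norm_inverse_one_sub_apply_le {k : K →L[ℂ] K} {δ : ℝ} (hδ : 0 < δ) (hk : ‖k‖ ≤ 1 - δ)
    (g : K) : ‖Ring.inverse (1 - k) g‖ ≤ δ⁻¹ * ‖g‖ := by
  have hu : IsUnit (1 - k) := isUnit_one_sub_of_norm_lt_one (by linarith)
  set x := Ring.inverse (1 - k) g with hx
  have h1 : x - k x = g := DFunLike.congr_fun (Ring.mul_inverse_cancel _ hu) g
  have h2 := norm_sub_norm_le x (k x)
  have h3 := k.le_of_opNorm_le hk x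
  rw [h1] at h2
  rw [inv_mul_eq_div, le_div_iff₀ hδ]
  linarith

omit [CompleteSpace K] in
theorem normProd_nonneg (T₀ : H →ₗ.[ℂ] H) (A B : H →ₗ.[ℂ] K) (α s : ℝ) :
    0 ≤ normProd T₀ A B α s :=
  mul_nonneg (norm_nonneg _) (norm_nonneg _)

/-- The constant that relates `(T + ε)^{-β} (T + ε)^{β - 1}`, with our normalization, and the
resolvent. -/
noncomputable def resConst (β : ℝ) : ℝ :=
  (Real.sin (Real.pi * β) / Real.pi * (Real.sin (Real.pi * (1 - β)) / Real.pi) * prodConst β)⁻¹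

/-- The standing assumptions on fractional powers. -/
structure FracHypotheses (T₀ : H →ₗ.[ℂ] H) (A B : H →ₗ.[ℂ] K) (α : ℝ) : Prop where
  hyp : Hypotheses T₀ A B
  pos : 0 < α
  lt_one : α < 1
  accretive : IsMAccretive T₀
  le_A : (fracPow T₀ (1 - α)).domain ≤ A.domain
  le_B : (fracPow T₀.adjoint (1 - α)).domain ≤ B.domain

namespace FracHypotheses

variable {α : ℝ} (h : FracHypotheses T₀ A B α)
include h

omit [CompleteSpace K] in
theorem one_sub_pos : 0 < 1 - α := by linarith [h.lt_one]

omit [CompleteSpace K] in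
theorem one_sub_lt : 1 - α < 1 := by linarith [h.pos]

omit [CompleteSpace K] in
theorem negPow_mem {s : ℝ} (hs : 0 < s) (f : H) : negPow T₀ s (1 - α) f ∈ A.domain := by
  refine h.le_A ?_
  rw [h.accretive.fracPow_domain h.one_sub_pos h.one_sub_lt hs]
  exact LinearMap.mem_range_self _ f

omit [CompleteSpace K] in
theorem adjoint_negPow_mem {s : ℝ} (hs : 0 < s) (f : H) :
    ContinuousLinearMap.adjoint (negPow T₀ s (1 - α)) f ∈ B.domain := by
  refine h.le_B ?_
  rw [h.accretive.adjoint.fracPow_domain h.one_sub_pos h.one_sub_lt hs,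
    h.accretive.negPow_adjoint h.one_sub_pos h.one_sub_lt hs]
  exact LinearMap.mem_range_self _ f

theorem left_resolvent_eq {s : ℝ} (hs : 0 < s) :
    bddClosure (prod A (ofCLM (resolvent T₀ (-(s : ℂ))))) =
      bddClosure (prod A (ofCLM (negPow T₀ s (1 - α)))) ∘L
        (resConst (1 - α) • negPow T₀ s α) := by
  refine bddClosure_prod_ofCLM_comp h.hyp.closed_A (h.negPow_mem hs) ?_
  rw [h.accretive.resolvent_eq_smul_negPow_comp h.one_sub_pos h.one_sub_lt hs,
    sub_sub_cancel, resConst, sub_sub_cancel]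
  exact (mul_smul_comm _ _ _).symm

theorem right_resolvent_eq {s : ℝ} (hs : 0 < s) :
    bddClosure (prod (ofCLM (resolvent T₀ (-(s : ℂ)))) B.adjoint) =
      (resConst α • negPow T₀ s α) ∘L
        bddClosure (prod (ofCLM (negPow T₀ s (1 - α))) B.adjoint) := by
  refine bddClosure_comp_ofCLM_prod_adjoint h.hyp.dense_B h.hyp.closed_B
    (h.adjoint_negPow_mem hs) ?_
  rw [h.accretive.resolvent_eq_smul_negPow_comp h.pos h.lt_one hs, resConst]
  exact (smul_mul_assoc _ _ _).symm

/-- Both factors at `s'` arise from those at `s` by composition with the same quotient `C`, so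
`normProd` is decreasing up to a constant. -/
theorem normProd_le {s s' : ℝ} (hs : 0 < s) (hs' : s ≤ s') :
    normProd T₀ A B α s' ≤ (1 + quotConst (1 - α)) ^ 2 * normProd T₀ A B α s := by
  obtain ⟨C, hC, h1, h2⟩ :=
    h.accretive.exists_negPow_quot h.one_sub_pos h.one_sub_lt hs hs'
  have e1 := bddClosure_prod_ofCLM_comp h.hyp.closed_A (h.negPow_mem hs) h2
  have e2 := bddClosure_comp_ofCLM_prod_adjoint h.hyp.dense_B h.hyp.closed_B
    (h.adjoint_negPow_mem hs) h1
  have hq := quotConst_nonneg (1 - α)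
  rw [normProd, normProd, e1, e2]
  calc _ ≤ ((1 + quotConst (1 - α)) * _) * (_ * (1 + quotConst (1 - α))) :=
        mul_le_mul ((ContinuousLinearMap.opNorm_comp_le _ _).trans
          (mul_le_mul_of_nonneg_right hC (norm_nonneg _)))
          ((ContinuousLinearMap.opNorm_comp_le _ _).trans
          (mul_le_mul_of_nonneg_left hC (norm_nonneg _))) (norm_nonneg _)
          (mul_nonneg (by linarith) (norm_nonneg _))
    _ = _ := by ring

end FracHypotheses

/-- The constant in the estimate of the difference of the resolvents. -/
noncomputable def diffConst (α δ : ℝ) : ℝ :=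
  |resConst α| * negPowConst α * (δ⁻¹ * |resConst (1 - α)|) * (1 + quotConst α)

theorem negPowConst_nonneg {β : ℝ} (h0 : 0 < β) (h1 : β < 1) : 0 ≤ negPowConst β :=
  mul_nonneg (sin_div_pi_pos h0 h1).le (fracConst_nonneg _)

theorem diffConst_nonneg {α δ : ℝ} (h0 : 0 < α) (h1 : α < 1) (hδ : 0 < δ) :
    0 ≤ diffConst α δ := by
  have := negPowConst_nonneg h0 h1
  have := quotConst_nonneg α
  unfold diffConst
  positivity

namespace FracHypotheses

variable {α : ℝ} (h : FracHypotheses T₀ A B α)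
include h

/-- The bound on `K(-s)` makes `-s` admissible by a Neumann series. In Kato's formula each outer
resolvent is then split into fractional powers, with the exponent `α - 1` next to `A` or `B*`. -/
theorem resolvent_sub_eq (hT : IsMAccretive (katoSum T₀ A B)) {δ s : ℝ} (hδ : 0 < δ) (hs : 0 < s)
    (hK : ‖birmanSchwinger T₀ A B (-(s : ℂ))‖ ≤ 1 - δ) (f : H) :
    (resolvent (katoSum T₀ A B) (-(s : ℂ)) - resolvent T₀ (-(s : ℂ))) f =
      -(resConst α • negPow T₀ s α)
        (bddClosure (prod (ofCLM (negPow T₀ s (1 - α))) B.adjoint)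
          (Ring.inverse (1 - birmanSchwinger T₀ A B (-(s : ℂ)))
            (bddClosure (prod A (ofCLM (negPow T₀ s (1 - α))))
              ((resConst (1 - α) • negPow T₀ s α) f)))) := by
  have hre : 0 < ((s : ℂ)).re := by simpa using hs
  have hadm : -(s : ℂ) ∈ admissible T₀ A B := by
    refine ⟨(h.accretive s hre).1, ?_⟩
    rw [spectrum.mem_resolventSet_iff, map_one]
    exact isUnit_one_sub_of_norm_lt_one (by linarith)
  rw [h.hyp.resolvent_katoSum hadm (hT s hre).1, katoResolvent, h.left_resolvent_eq hs,
    h.right_resolvent_eq hs, sub_sub_cancel_left]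
  rfl

/-- The left factor `(T₀ + s)^{-α}` provides the decay `s^{-α}`; the right one stays on `f` and is
compared with its value at `E`. -/
theorem norm_inner_resolvent_sub_le (hT : IsMAccretive (katoSum T₀ A B)) {δ s E : ℝ} (hδ : 0 < δ)
    (hE : 0 < E) (hs : E ≤ s) (hK : ‖birmanSchwinger T₀ A B (-(s : ℂ))‖ ≤ 1 - δ) (f g : H) :
    ‖⟪g, (resolvent (katoSum T₀ A B) (-(s : ℂ)) - resolvent T₀ (-(s : ℂ))) f⟫‖ ≤
      diffConst α δ * (s ^ (-α) * normProd T₀ A B α s) * (‖g‖ * ‖negPow T₀ E α f‖) := by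
  have hs0 := hE.trans_le hs
  obtain ⟨C, hC, h1, -⟩ := h.accretive.exists_negPow_quot h.pos h.lt_one hE hs
  rw [h.resolvent_sub_eq hT hδ hs0 hK, inner_neg_right, norm_neg]
  refine (norm_inner_le_norm _ _).trans ?_
  have hf : ‖negPow T₀ s α f‖ ≤ (1 + quotConst α) * ‖negPow T₀ E α f‖ := by
    rw [h1]
    exact C.le_of_opNorm_le hC _
  have hn := h.accretive.norm_negPow_le h.pos h.lt_one hs0
  have hn0 := negPowConst_nonneg h.pos h.lt_one
  rw [smul_apply, smul_apply, norm_smul, Real.norm_eq_abs, ContinuousLinearMap.map_smul_of_tower]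
  set p := bddClosure (prod (ofCLM (negPow T₀ s (1 - α))) B.adjoint) with hp
  set q := bddClosure (prod A (ofCLM (negPow T₀ s (1 - α)))) with hq
  calc _ ≤ ‖g‖ * (|resConst α| * ((negPowConst α * s ^ (-α)) * (‖p‖ * (δ⁻¹ *
        (|resConst (1 - α)| * (‖q‖ * ((1 + quotConst α) * ‖negPow T₀ E α f‖))))))) := by
        gcongr
        refine (ContinuousLinearMap.le_of_opNorm_le _ hn _).trans ?_
        gcongr
        refine (p.le_opNorm _).trans ?_
        gcongr
        refine (norm_inverse_one_sub_apply_le hδ hK _).trans ?_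
        gcongr
        rw [norm_smul, Real.norm_eq_abs]
        gcongr
        refine (q.le_opNorm _).trans ?_
        gcongr
    _ = _ := by
        rw [normProd, diffConst]
        ring

/-- The outer factors exchange roles: the left one moves to `g` as an adjoint and the right one
provides the decay. This serves the bound for the adjoints. -/
theorem norm_inner_resolvent_sub_le' (hT : IsMAccretive (katoSum T₀ A B)) {δ s E : ℝ} (hδ : 0 < δ)
    (hE : 0 < E) (hs : E ≤ s) (hK : ‖birmanSchwinger T₀ A B (-(s : ℂ))‖ ≤ 1 - δ) (f g : H) :
    ‖⟪g, (resolvent (katoSum T₀ A B) (-(s : ℂ)) - resolvent T₀ (-(s : ℂ))) f⟫‖ ≤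
      diffConst α δ * (s ^ (-α) * normProd T₀ A B α s) *
        (‖f‖ * ‖ContinuousLinearMap.adjoint (negPow T₀ E α) g‖) := by
  have hs0 := hE.trans_le hs
  obtain ⟨C, hC, -, h1⟩ := h.accretive.exists_negPow_quot h.pos h.lt_one hE hs
  have hg : ‖ContinuousLinearMap.adjoint (negPow T₀ s α) g‖ ≤
      (1 + quotConst α) * ‖ContinuousLinearMap.adjoint (negPow T₀ E α) g‖ := by
    rw [h1, ContinuousLinearMap.adjoint_comp]
    exact (ContinuousLinearMap.adjoint C).le_of_opNorm_le
      ((LinearIsometryEquiv.norm_map _ _).trans_le hC) _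
  have hn := h.accretive.norm_negPow_le h.pos h.lt_one hs0
  have hn0 := negPowConst_nonneg h.pos h.lt_one
  rw [h.resolvent_sub_eq hT hδ hs0 hK, inner_neg_right, norm_neg]
  rw [smul_apply, smul_apply, ← Complex.coe_smul, inner_smul_right, norm_mul, Complex.norm_real,
    Real.norm_eq_abs, ContinuousLinearMap.map_smul_of_tower,
    ← ContinuousLinearMap.adjoint_inner_left]
  set p := bddClosure (prod (ofCLM (negPow T₀ s (1 - α))) B.adjoint) with hp
  set q := bddClosure (prod A (ofCLM (negPow T₀ s (1 - α)))) with hq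
  calc _ ≤ |resConst α| * (((1 + quotConst α) * ‖ContinuousLinearMap.adjoint (negPow T₀ E α) g‖) *
        (‖p‖ * (δ⁻¹ * (|resConst (1 - α)| * (‖q‖ * ((negPowConst α * s ^ (-α)) * ‖f‖)))))) := by
        gcongr
        refine (norm_inner_le_norm _ _).trans ?_
        gcongr
        · exact mul_nonneg (add_nonneg zero_le_one (quotConst_nonneg _)) (norm_nonneg _)
        refine (p.le_opNorm _).trans ?_
        gcongr
        refine (norm_inverse_one_sub_apply_le hδ hK _).trans ?_
        gcongr
        rw [norm_smul, Real.norm_eq_abs]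
        gcongr
        refine (q.le_opNorm _).trans ?_
        gcongr
        exact ContinuousLinearMap.le_of_opNorm_le _ hn _
    _ = _ := by
        rw [normProd, diffConst]
        ring

/-- The integral at `E - 2R`, restricted to `R < t ≤ 2R`, controls `normProd` at `E`: there `E - 2R
+ t ≤ E`, so almost-monotonicity applies, and `t^{-2α} ≥ (2R)^{-2α}`. -/
theorem tendsto_normProd {R E₀ : ℝ} (hR : 0 < R) (hE₀ : 0 < E₀)
    (hint : ∀ E : ℝ, E₀ ≤ E → IntegrableOn
      (fun t : ℝ => t ^ (-2 * α) * normProd T₀ A B α (E + t)) (Set.Ioi R))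
    (hlim : Tendsto
      (fun E : ℝ => ∫ t in Set.Ioi R, t ^ (-2 * α) * normProd T₀ A B α (E + t)) atTop (𝓝 0)) :
    Tendsto (fun E => normProd T₀ A B α E) atTop (𝓝 0) := by
  set c := (1 + quotConst (1 - α)) ^ 2 with hc
  have hc0 : 0 ≤ c := by positivity
  have hpow : 0 < (2 * R) ^ (-2 * α) := by positivity
  have hlim2 : Tendsto (fun E : ℝ => (R * (2 * R) ^ (-2 * α))⁻¹ * (c *
      ∫ t in Set.Ioi R, t ^ (-2 * α) * normProd T₀ A B α ((E - 2 * R) + t))) atTop (𝓝 0) := by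
    have := ((hlim.comp (tendsto_atTop_add_const_right atTop (-(2 * R)) tendsto_id)).const_mul
      c).const_mul (R * (2 * R) ^ (-2 * α))⁻¹
    simpa [sub_eq_add_neg] using this
  refine squeeze_zero' (Eventually.of_forall fun E => normProd_nonneg _ _ _ _ _) ?_ hlim2
  filter_upwards [eventually_ge_atTop (E₀ + 2 * R)] with E hE
  have hi := hint (E - 2 * R) (by linarith)
  rw [inv_mul_eq_div, le_div_iff₀ (by positivity)]
  have hsub : Set.Ioc R (2 * R) ⊆ Set.Ioi R := fun t ht => ht.1
  calc normProd T₀ A B α E * (R * (2 * R) ^ (-2 * α))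
      = ∫ t in Set.Ioc R (2 * R), (2 * R) ^ (-2 * α) * normProd T₀ A B α E := by
        rw [setIntegral_const, Real.volume_real_Ioc_of_le (by linarith), smul_eq_mul]
        ring
    _ ≤ ∫ t in Set.Ioc R (2 * R), c * (t ^ (-2 * α) * normProd T₀ A B α ((E - 2 * R) + t)) := by
        refine setIntegral_mono_on (integrableOn_const (by simp)) ((hi.mono_set hsub).const_mul _)
          measurableSet_Ioc fun t ht => ?_
        have ht0 : 0 < t := hR.trans ht.1
        have h1 := h.normProd_le (s := E - 2 * R + t) (s' := E) (by linarith) (by linarith [ht.2])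
        calc _ ≤ t ^ (-2 * α) * (c * normProd T₀ A B α (E - 2 * R + t)) := by
              refine mul_le_mul ?_ h1 (normProd_nonneg _ _ _ _ _) (by positivity)
              exact Real.rpow_le_rpow_of_nonpos ht0 ht.2 (by linarith [h.pos])
          _ = _ := by ring
    _ ≤ ∫ t in Set.Ioi R, c * (t ^ (-2 * α) * normProd T₀ A B α ((E - 2 * R) + t)) := by
        refine setIntegral_mono_set (hi.const_mul _) ?_ hsub.eventuallyLE
        filter_upwards [ae_restrict_mem measurableSet_Ioi] with t ht
        have ht0 : 0 < t := hR.trans ht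
        exact mul_nonneg hc0 (mul_nonneg (by positivity) (normProd_nonneg _ _ _ _ _))
    _ = _ := integral_const_mul _ _

/-- The integral is split at `R`. Near `0`, `E ≥ 1` gives `(E + t)^{-α} ≤ 1` and `normProd` is
controlled by its value at `E`; beyond `R`, `(E + t)^{-α} ≤ t^{-α}` produces the weight `t^{-2α}` of
the hypothesis. -/
theorem norm_integral_le {R E X : ℝ} (hR : 0 < R) (hE : 1 ≤ E) (hX : 0 ≤ X)
    (hint : IntegrableOn (fun t : ℝ => t ^ (-2 * α) * normProd T₀ A B α (E + t)) (Set.Ioi R))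
    {F : ℝ → ℂ} (hF : ∀ t, 0 < t → ‖F t‖ ≤ (E + t) ^ (-α) * normProd T₀ A B α (E + t) * X) :
    ‖∫ t in Set.Ioi (0 : ℝ), ((t ^ (-α) : ℝ) : ℂ) * F t‖ ≤
      ((∫ t in Set.Ioc 0 R, t ^ (-α)) * ((1 + quotConst (1 - α)) ^ 2 * normProd T₀ A B α E) +
        ∫ t in Set.Ioi R, t ^ (-2 * α) * normProd T₀ A B α (E + t)) * X := by
  set c := (1 + quotConst (1 - α)) ^ 2 with hc
  have hc0 : 0 ≤ c := by positivity
  set b : ℝ → ℝ := fun t => (if t ≤ R then t ^ (-α) * (c * normProd T₀ A B α E) else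
    t ^ (-2 * α) * normProd T₀ A B α (E + t)) * X with hb
  have e1 : Set.EqOn b (fun t => t ^ (-α) * (c * normProd T₀ A B α E) * X) (Set.Ioc 0 R) := by
    intro t ht
    simp only [hb, if_pos ht.2]
  have e2 : Set.EqOn b (fun t => t ^ (-2 * α) * normProd T₀ A B α (E + t) * X) (Set.Ioi R) := by
    intro t ht
    simp only [hb, if_neg (not_le.2 (Set.mem_Ioi.1 ht))]
  have hrp : IntegrableOn (fun t : ℝ => t ^ (-α)) (Set.Ioc 0 R) :=
    (intervalIntegrable_iff_integrableOn_Ioc_of_le hR.le).1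
      (intervalIntegral.intervalIntegrable_rpow' (by linarith [h.lt_one]))
  have i1 : IntegrableOn b (Set.Ioc 0 R) :=
    (integrableOn_congr_fun e1 measurableSet_Ioc).2 ((hrp.mul_const _).mul_const _)
  have i2 : IntegrableOn b (Set.Ioi R) :=
    (integrableOn_congr_fun e2 measurableSet_Ioi).2 (hint.mul_const _)
  have hbint : ∫ t in Set.Ioi (0 : ℝ), b t =
      ((∫ t in Set.Ioc 0 R, t ^ (-α)) * (c * normProd T₀ A B α E) +
        ∫ t in Set.Ioi R, t ^ (-2 * α) * normProd T₀ A B α (E + t)) * X := by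
    rw [← Set.Ioc_union_Ioi_eq_Ioi hR.le, setIntegral_union Set.Ioc_disjoint_Ioi_same
      measurableSet_Ioi i1 i2, setIntegral_congr_fun measurableSet_Ioc e1,
      setIntegral_congr_fun measurableSet_Ioi e2, integral_mul_const, integral_mul_const,
      integral_mul_const, add_mul]
  rw [← hbint]
  refine norm_integral_le_of_norm_le ?_ ?_
  · rw [← Set.Ioc_union_Ioi_eq_Ioi hR.le]
    exact i1.union i2
  filter_upwards [ae_restrict_mem measurableSet_Ioi] with t ht
  have ht0 : 0 < t := ht
  have hN := normProd_nonneg T₀ A B α (E + t)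
  rw [norm_mul, Complex.norm_real, Real.norm_of_nonneg (by positivity)]
  refine (mul_le_mul_of_nonneg_left (hF t ht0) (by positivity)).trans ?_
  rw [← mul_assoc]
  refine mul_le_mul_of_nonneg_right ?_ hX
  by_cases htR : t ≤ R
  · rw [if_pos htR]
    have h1 : (E + t) ^ (-α) ≤ 1 :=
      Real.rpow_le_one_of_one_le_of_nonpos (by linarith) (by linarith [h.pos])
    have h2 := h.normProd_le (s := E) (s' := E + t) (by linarith) (by linarith)
    refine mul_le_mul_of_nonneg_left ?_ (by positivity)
    calc _ ≤ 1 * normProd T₀ A B α (E + t) := mul_le_mul_of_nonneg_right h1 hN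
      _ ≤ _ := by rw [one_mul]; exact h2
  · rw [if_neg htR, ← mul_assoc]
    refine mul_le_mul_of_nonneg_right ?_ hN
    have h1 : (E + t) ^ (-α) ≤ t ^ (-α) :=
      Real.rpow_le_rpow_of_nonpos ht0 (by linarith) (by linarith [h.pos])
    calc _ ≤ t ^ (-α) * t ^ (-α) := mul_le_mul_of_nonneg_left h1 (by positivity)
      _ = t ^ (-2 * α) := by
        rw [← Real.rpow_add ht0]
        congr 1
        ring

/-- The relative bound of the difference of the fractional powers of `T + E` and `T₀ + E`. -/
theorem exists_relative_bound (hT : IsMAccretive (katoSum T₀ A B)) {R E₀ δ : ℝ} (hR : 0 < R)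
    (hE₀ : 0 < E₀) (hδ : 0 < δ)
    (hint : ∀ E : ℝ, E₀ ≤ E → IntegrableOn
      (fun t : ℝ => t ^ (-2 * α) * normProd T₀ A B α (E + t)) (Set.Ioi R))
    (hlim : Tendsto
      (fun E : ℝ => ∫ t in Set.Ioi R, t ^ (-2 * α) * normProd T₀ A B α (E + t)) atTop (𝓝 0))
    (hK : ∀ E : ℝ, E₀ ≤ E → ‖birmanSchwinger T₀ A B (-(E : ℂ))‖ ≤ 1 - δ) :
    ∃ E κ : ℝ, 0 < E ∧ κ < 1 ∧
      (∀ f, ‖(negPow (katoSum T₀ A B) E α - negPow T₀ E α) f‖ ≤ κ * ‖negPow T₀ E α f‖) ∧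
      ∀ g, ‖(ContinuousLinearMap.adjoint (negPow (katoSum T₀ A B) E α) -
        ContinuousLinearMap.adjoint (negPow T₀ E α)) g‖ ≤
          κ * ‖ContinuousLinearMap.adjoint (negPow T₀ E α) g‖ := by
  set κ : ℝ → ℝ := fun E => Real.sin (Real.pi * α) / Real.pi * (diffConst α δ *
    ((∫ t in Set.Ioc 0 R, t ^ (-α)) * ((1 + quotConst (1 - α)) ^ 2 * normProd T₀ A B α E) +
        ∫ t in Set.Ioi R, t ^ (-2 * α) * normProd T₀ A B α (E + t))) with hκ
  have hκlim : Tendsto κ atTop (𝓝 0) := by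
    have := ((((((h.tendsto_normProd hR hE₀ hint hlim).const_mul
      ((1 + quotConst (1 - α)) ^ 2)).const_mul (∫ t in Set.Ioc 0 R, t ^ (-α))).add hlim).const_mul
        (diffConst α δ)).const_mul (Real.sin (Real.pi * α) / Real.pi))
    simp only [mul_zero, add_zero] at this
    exact this
  -- `E` must be at least `1` for the estimate near `t = 0`, at least `E₀` for the hypotheses, and
  -- large enough that the relative bound is below one.
  obtain ⟨E, ⟨hE1, hE2⟩, hE3⟩ := (((eventually_ge_atTop (1 : ℝ)).and
    (eventually_ge_atTop E₀)).and (hκlim.eventually_lt_const one_pos)).exists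
  have hE0 : 0 < E := by linarith
  have hD := diffConst_nonneg h.pos h.lt_one hδ
  have hsin := sin_div_pi_pos h.pos h.lt_one
  have main : ∀ (X : ℝ) (f g : H), 0 ≤ X → (∀ t, 0 < t →
      ‖⟪g, (resolvent (katoSum T₀ A B) (-((E + t : ℝ) : ℂ)) -
        resolvent T₀ (-((E + t : ℝ) : ℂ))) f⟫‖ ≤
        diffConst α δ * ((E + t) ^ (-α) * normProd T₀ A B α (E + t)) * X) →
      ‖⟪g, (negPow (katoSum T₀ A B) E α - negPow T₀ E α) f⟫‖ ≤ κ E * X := by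
    intro X f g hX hF
    rw [hT.inner_negPow_sub h.accretive h.pos h.lt_one hE0, norm_mul, Complex.norm_real,
      Real.norm_of_nonneg hsin.le]
    have := h.norm_integral_le hR hE1 (mul_nonneg hD hX) (hint E hE2)
      (F := fun t => ⟪g, (resolvent (katoSum T₀ A B) (-((E + t : ℝ) : ℂ)) -
        resolvent T₀ (-((E + t : ℝ) : ℂ))) f⟫)
      (fun t ht => (hF t ht).trans (le_of_eq (by ring)))
    refine (mul_le_mul_of_nonneg_left this hsin.le).trans (le_of_eq ?_)
    simp only [hκ]
    ring
  have hκ0 : 0 ≤ κ E := by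
    refine mul_nonneg hsin.le (mul_nonneg hD (add_nonneg (mul_nonneg ?_ (mul_nonneg (by positivity)
      (normProd_nonneg _ _ _ _ _))) ?_))
    · refine setIntegral_nonneg measurableSet_Ioc fun t ht => ?_
      have : 0 < t := ht.1
      positivity
    · refine setIntegral_nonneg measurableSet_Ioi fun t ht => ?_
      have : 0 < t := hR.trans ht
      exact mul_nonneg (by positivity) (normProd_nonneg _ _ _ _ _)
  refine ⟨E, κ E, hE0, hE3, fun f => ?_, fun g => ?_⟩
  · refine norm_le_of_inner_le (mul_nonneg hκ0 (norm_nonneg _)) fun g => ?_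
    rw [norm_inner_symm]
    refine (main (‖g‖ * ‖negPow T₀ E α f‖) f g (by positivity) fun t ht =>
      h.norm_inner_resolvent_sub_le hT hδ hE0 (by linarith) (hK _ (by linarith)) f g).trans
        (le_of_eq (by ring))
  · refine norm_le_of_inner_le (mul_nonneg hκ0 (norm_nonneg _)) fun f => ?_
    rw [← map_sub, ContinuousLinearMap.adjoint_inner_left]
    refine (main (‖f‖ * ‖ContinuousLinearMap.adjoint (negPow T₀ E α) g‖) f g (by positivity)
      fun t ht => h.norm_inner_resolvent_sub_le' hT hδ hE0 (by linarith) (hK _ (by linarith))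
        f g).trans (le_of_eq (by ring))

end FracHypotheses

end Estimates
end KatoSum

theorem theorem2p9 {H K : Type*}
    [NormedAddCommGroup H] [InnerProductSpace ℂ H] [CompleteSpace H]
    [NormedAddCommGroup K] [InnerProductSpace ℂ K] [CompleteSpace K]
    (T₀ : H →ₗ.[ℂ] H) (A B : H →ₗ.[ℂ] K) (α : ℝ) (hα : α ∈ Set.Ioo (0 : ℝ) 1)
    (hyp : KatoSum.Hypotheses T₀ A B)
    (hT₀ : KatoSum.IsMAccretive T₀)
    (hT : KatoSum.IsMAccretive (KatoSum.katoSum T₀ A B))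
    (hdom : (KatoSum.fracPow T₀ α).domain = (KatoSum.fracPow T₀.adjoint α).domain)
    (hA : (KatoSum.fracPow T₀ (1 - α)).domain ≤ A.domain)
    (hB : (KatoSum.fracPow T₀.adjoint (1 - α)).domain ≤ B.domain)
    (R E₀ δ : ℝ) (hR : 0 < R) (hE₀ : 0 < E₀) (hδ : δ ∈ Set.Ioo (0 : ℝ) 1)
    (hint : ∀ E : ℝ, E₀ ≤ E → MeasureTheory.IntegrableOn
      (fun t : ℝ => t ^ (-2 * α) * KatoSum.normProd T₀ A B α (E + t)) (Set.Ioi R))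
    (hlim : Filter.Tendsto
      (fun E : ℝ => ∫ t in Set.Ioi R, t ^ (-2 * α) * KatoSum.normProd T₀ A B α (E + t))
      Filter.atTop (nhds 0))
    (hK : ∀ E : ℝ, E₀ ≤ E → ‖KatoSum.birmanSchwinger T₀ A B (-(E : ℂ))‖ ≤ 1 - δ) :
    (KatoSum.fracPow (KatoSum.katoSum T₀ A B) α).domain = (KatoSum.fracPow T₀ α).domain ∧
      (KatoSum.fracPow T₀ α).domain = (KatoSum.fracPow T₀.adjoint α).domain ∧
      (KatoSum.fracPow T₀.adjoint α).domain =
        (KatoSum.fracPow (KatoSum.katoSum T₀ A B).adjoint α).domain := by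
  have h : KatoSum.FracHypotheses T₀ A B α := ⟨hyp, hα.1, hα.2, hT₀, hA, hB⟩
  obtain ⟨E, κ, hE, hκ, h1, h2⟩ := h.exists_relative_bound hT hR hE₀ hδ.1 hint hlim hK
  -- The range lemma concerns adjoints, so `h1` settles `T*` and `T₀*`, while the bound `h2` for the
  -- adjoints settles `T` and `T₀`.
  have e1 := KatoSum.range_adjoint_eq_of_norm_sub_le _ _ hκ h1
  have e2 := KatoSum.range_adjoint_eq_of_norm_sub_le _ _ hκ h2
  rw [ContinuousLinearMap.adjoint_adjoint, ContinuousLinearMap.adjoint_adjoint] at e2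
  refine ⟨?_, hdom, ?_⟩
  · rw [hT.fracPow_domain hα.1 hα.2 hE, hT₀.fracPow_domain hα.1 hα.2 hE, e2]
  · rw [hT.adjoint.fracPow_domain hα.1 hα.2 hE, hT₀.adjoint.fracPow_domain hα.1 hα.2 hE,
      hT.negPow_adjoint hα.1 hα.2 hE, hT₀.negPow_adjoint hα.1 hα.2 hE, e1]
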